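/- Let $d\in\{2,3\}$ and let $\Omega\subset\mathbb R^d$ be a convex polygonal ($d=2$) or polyhedral ($d=3$) domain, i.e. a nonempty set that is the interior of the convex hull of finitely many points. Write $(\cdot,\cdot)$ and $\|\cdot\|$ for the inner product and norm of $L^2(\Omega)$ (scalar or vector valued), let $H^1_0(\Omega)$ be the closure of $C_c^\infty(\Omega)$ in $H^1(\Omega)$, and let $H^{-1}(\Omega)$ be its dual with the norm $\|F\|_{H^{-1}}=\sup_{0\ne v\in H^1_0(\Omega)}|F(v)|/\|\nabla v\|$. Let $\lambda_1$ be the minimum eigenvalue of the Dirichlet Laplacian: the smallest $\lambda$ for which there is $0\ne\varphi\in H^1_0(\Omega)$ with $(\nabla\varphi,\nabla v)=\lambda(\varphi,v)$ for all $v\in H^1_0(\Omega)$. Let $f\in L^\infty(0,\infty;H^{-1}(\Omega))$, with norm $\|f\|_{L^\infty(H^{-1})}=\operatorname{ess\,sup}_{t>0}\|f(t)\|_{H^{-1}}$, and $u_0\in L^2(\Omega)$. Let $u$ be a weak solution of $$u_t-\bigl(1+\|\nabla u(t)\|^2\bigr)\Delta u=f\ \text{ in }\Omega\times(0,\infty),\qquad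 u=0\ \text{ on }\partial\Omega\times(0,\infty),\qquad u(0)=u_0,$$ that is: $u\in C([0,\infty);L^2(\Omega))\cap L^2(0,T;H^1_0(\Omega))$ for all finite $T>0$, $u(0)=u_0$, and for every $v\in H^1_0(\Omega)$ the function $t\mapsto(u(t),v)$ is absolutely continuous on every compact subinterval of $(0,\infty)$ and satisfies, for almost every $t>0$, $$\frac{d}{dt}(u(t),v)+\bigl(1+\|\nabla u(t)\|^2\bigr)(\nabla u(t),\nabla v)=\langle f(t),v\rangle .$$ Then the minimum eigenvalue $\lambda_1$ exists and $\lambda_1>0$. For every $\alpha$ with $0<\alpha<\lambda_1/2$, one has $\beta:=1-\frac{2\alpha}{\lambda_1}>0$, and for every $t\ge 0$ the two integrals below are finite and $$\|u(t)\|^2+\beta e^{-2\alpha t}\int_0^t e^{2\alpha s}\|\nabla u(s)\|^2\,ds+2e^{-2\alpha t}\int_0^t e^{2\alpha s}\|\nabla u(s)\|^4\,ds \le e^{-2\alpha t}\|u_0\|^2+\frac1{2\alpha}\|f\|^2_{L^\infty(H^{-1})}\bigl(1-e^{-2\alpha t}\bigr)\le\|u_0\|^2+\frac1{2\alpha}\|f\|^2_{L^\infty(H^{-1})}.$$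 -/

import Mathlib

open MeasureTheory Set
open scoped ContDiff ENNReal RealInnerProductSpace

noncomputable section

namespace KirchhoffParabolic

/-- A convex polygonal (`d = 2`) or polyhedral (`d = 3`) domain: a nonempty set that is the
interior of the convex hull of finitely many points. -/
def IsConvexPolytopalDomain {d : ℕ} (Ω : Set (EuclideanSpace ℝ (Fin d))) : Prop :=
  Ω.Nonempty ∧ ∃ s : Finset (EuclideanSpace ℝ (Fin d)), Ω = interior (convexHull ℝ (s : Set _))

/-- The space `L²(Ω)` of real functions. -/
abbrev L2 {d : ℕ} (Ω : Set (EuclideanSpace ℝ (Fin d))) : Type :=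
  Lp ℝ 2 (volume.restrict Ω)

/-- The space `L²(Ω; ℝᵈ)` of vector fields. -/
abbrev L2Vec {d : ℕ} (Ω : Set (EuclideanSpace ℝ (Fin d))) : Type :=
  Lp (EuclideanSpace ℝ (Fin d)) 2 (volume.restrict Ω)

/-- Smooth functions with compact support contained in `Ω`. -/
def IsTestFunction {d : ℕ} (Ω : Set (EuclideanSpace ℝ (Fin d)))
    (φ : EuclideanSpace ℝ (Fin d) → ℝ) : Prop :=
  ContDiff ℝ ∞ φ ∧ HasCompactSupport φ ∧ tsupport φ ⊆ Ω

/-- The pairs `(φ, ∇φ)` with `φ` a test function, as a subspace of `L²(Ω) × L²(Ω; ℝᵈ)`; the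
product carries the inner product `(v, w) + (∇v, ∇w)` of `H¹(Ω)`. -/
def testPairs {d : ℕ} (Ω : Set (EuclideanSpace ℝ (Fin d))) :
    Submodule ℝ (WithLp 2 (L2 Ω × L2Vec Ω)) where
  carrier := {p | ∃ φ : EuclideanSpace ℝ (Fin d) → ℝ, IsTestFunction Ω φ ∧
    p.fst =ᵐ[volume.restrict Ω] φ ∧ p.snd =ᵐ[volume.restrict Ω] gradient φ}
  zero_mem' := by
    refine ⟨0, ⟨contDiff_const, HasCompactSupport.zero, by simp [tsupport]⟩, ?_, ?_⟩
    · exact Lp.coeFn_zero _ _ _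
    · have h : gradient (0 : EuclideanSpace ℝ (Fin d) → ℝ) = 0 := by
        funext x; exact gradient_fun_const x 0
      rw [h]; exact Lp.coeFn_zero _ _ _
  add_mem' := by
    rintro p q ⟨φ, ⟨hφ, hφc, hφs⟩, hp, hp'⟩ ⟨ψ, ⟨hψ, hψc, hψs⟩, hq, hq'⟩
    refine ⟨φ + ψ, ⟨hφ.add hψ, hφc.add hψc,
      (tsupport_add φ ψ).trans (union_subset hφs hψs)⟩, ?_, ?_⟩
    · exact (Lp.coeFn_add p.fst q.fst).trans (hp.add hq)
    · have h : gradient (φ + ψ) = gradient φ + gradient ψ := by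
        funext x
        simp only [gradient, Pi.add_apply]
        rw [fderiv_add (hφ.differentiable (by simp) x) (hψ.differentiable (by simp) x), map_add]
      rw [h]; exact (Lp.coeFn_add p.snd q.snd).trans (hp'.add hq')
  smul_mem' := by
    rintro c p ⟨φ, ⟨hφ, hφc, hφs⟩, hp, hp'⟩
    refine ⟨c • φ, ⟨contDiff_const.smul hφ, hφc.smul_left (f := fun _ => c),
      (closure_mono (Function.support_const_smul_subset c φ)).trans hφs⟩, ?_, ?_⟩
    · exact (Lp.coeFn_smul c p.fst).trans (hp.const_smul c)
    · have h : gradient (c • φ) = c • gradient φ := by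
        funext x
        simp only [gradient, Pi.smul_apply]
        rw [fderiv_const_smul (hφ.differentiable (by simp) x)]
        simp
      rw [h]; exact (Lp.coeFn_smul c p.snd).trans (hp'.const_smul c)

/-- The Sobolev space `H¹₀(Ω)`: the closure of the test functions in the norm of `H¹(Ω)`. An
element is stored as the pair `(v, ∇v)` of a function and its weak gradient (the first component
determines the second one), and its norm is the `H¹` norm. -/
def H10 {d : ℕ} (Ω : Set (EuclideanSpace ℝ (Fin d))) :
    Submodule ℝ (WithLp 2 (L2 Ω × L2Vec Ω)) :=
  (testPairs Ω).topologicalClosure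

/-- The inclusion of `H¹₀(Ω)` in `L²(Ω)`. -/
def toL2 {d : ℕ} {Ω : Set (EuclideanSpace ℝ (Fin d))} : H10 Ω →L[ℝ] L2 Ω :=
  WithLp.fstL 2 ℝ (L2 Ω) (L2Vec Ω) ∘L (H10 Ω).subtypeL

/-- The weak gradient `v ↦ ∇v` on `H¹₀(Ω)`. -/
def grad {d : ℕ} {Ω : Set (EuclideanSpace ℝ (Fin d))} : H10 Ω →L[ℝ] L2Vec Ω :=
  WithLp.sndL 2 ℝ (L2 Ω) (L2Vec Ω) ∘L (H10 Ω).subtypeL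

/-- The set of eigenvalues of `-Δ` on `Ω` with homogeneous Dirichlet boundary condition. -/
def dirichletEigenvalues {d : ℕ} (Ω : Set (EuclideanSpace ℝ (Fin d))) : Set ℝ :=
  {μ | ∃ φ : H10 Ω, φ ≠ 0 ∧ ∀ v : H10 Ω, ⟪grad φ, grad v⟫ = μ * ⟪toL2 φ, toL2 v⟫}

/-- The smallest Dirichlet eigenvalue `λ₁` of `-Δ` on `Ω`. -/
def lambda1 {d : ℕ} (Ω : Set (EuclideanSpace ℝ (Fin d))) : ℝ :=
  sInf (dirichletEigenvalues Ω)

/-- The dual space `H⁻¹(Ω)` of `H¹₀(Ω)`. -/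
abbrev HNeg1 {d : ℕ} (Ω : Set (EuclideanSpace ℝ (Fin d))) : Type :=
  StrongDual ℝ (H10 Ω)

/-- The norm of `H⁻¹(Ω)` dual to the norm `‖∇v‖` of `H¹₀(Ω)`:
the supremum of `|F(v)| / ‖∇v‖` over `v`. -/
def negNorm {d : ℕ} {Ω : Set (EuclideanSpace ℝ (Fin d))} (F : HNeg1 Ω) : ℝ :=
  ⨆ v : H10 Ω, |F v| / ‖grad v‖

/-- `f ∈ L^∞(0, ∞; H⁻¹(Ω))`. -/
def MemLInftyHNeg1 {d : ℕ} {Ω : Set (EuclideanSpace ℝ (Fin d))} (f : ℝ → HNeg1 Ω) : Prop :=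
  AEStronglyMeasurable f (volume.restrict (Ioi 0)) ∧
    eLpNorm (fun t => negNorm (f t)) (⊤ : ℝ≥0∞) (volume.restrict (Ioi 0)) < (⊤ : ℝ≥0∞)

/-- The norm of `f` in `L^∞(0, ∞; H⁻¹(Ω))`, the essential supremum of `‖f(t)‖` over `t > 0`. -/
def lInftyNorm {d : ℕ} {Ω : Set (EuclideanSpace ℝ (Fin d))} (f : ℝ → HNeg1 Ω) : ℝ :=
  (eLpNorm (fun t => negNorm (f t)) (⊤ : ℝ≥0∞) (volume.restrict (Ioi 0))).toReal

/-- Weak solutions of `u_t - (1 + ‖∇u‖²) Δu = f` in `Ω × (0, ∞)`, `u = 0` on `∂Ω`,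
`u(0) = u₀`. Here `u : [0, ∞) → L²(Ω)`, and `U t` is `u t` regarded as an element of `H¹₀(Ω)`,
for almost every `t > 0`. The time derivative is taken weakly in space: for every
`v ∈ H¹₀(Ω)` the function `t ↦ (u(t), v)` is locally absolutely continuous, and almost everywhere
its derivative `(u_t, v)` satisfies `(u_t, v) + (1 + ‖∇u‖²)(∇u, ∇v) = ⟨f, v⟩`. -/
structure IsWeakSolution {d : ℕ} {Ω : Set (EuclideanSpace ℝ (Fin d))}
    (f : ℝ → HNeg1 Ω) (u₀ : L2 Ω) (u : ℝ → L2 Ω) (U : ℝ → H10 Ω) : Prop where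
  /-- `u ∈ C([0, ∞); L²(Ω))` -/
  continuousOn : ContinuousOn u (Ici 0)
  /-- `u(0) = u₀` -/
  initial : u 0 = u₀
  /-- `u(t) ∈ H¹₀(Ω)` for almost every `t > 0` -/
  toL2_ae_eq : ∀ᵐ t ∂(volume.restrict (Ioi (0 : ℝ))), toL2 (U t) = u t
  /-- `u ∈ L²(0, T; H¹₀(Ω))` for every finite `T` -/
  memLp : ∀ T : ℝ, 0 < T → MemLp U 2 (volume.restrict (Ioo 0 T))
  absolutelyContinuous : ∀ v : H10 Ω, ∀ a b : ℝ, 0 < a → a ≤ b →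
    AbsolutelyContinuousOnInterval (fun t => ⟪u t, toL2 v⟫) a b
  equation : ∀ v : H10 Ω, ∀ᵐ t ∂(volume.restrict (Ioi (0 : ℝ))),
    ∃ w : ℝ, HasDerivAt (fun s => ⟪u s, toL2 v⟫) w t ∧
      w + (1 + ‖grad (U t)‖ ^ 2) * ⟪grad (U t), grad v⟫ = f t v

end KirchhoffParabolic

end

open KirchhoffParabolic

universe u

namespace KirchhoffParabolic

/-! Formally one tests with u(t). With N = ‖f‖, Young's inequality gives (‖u‖²)' + 2(1 + ‖∇u‖²)‖∇u‖²
= 2⟨f, u⟩ ≤ N² + ‖∇u‖². Multiplying by e^{2αt} produces the extra term 2α‖u‖², which the sharp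
Poincaré inequality bounds by (2α/λ₁)‖∇u‖². What is left is (e^{2αt}‖u‖²)' + e^{2αt}(β‖∇u‖² +
2‖∇u‖⁴) ≤ N² e^{2αt}, to be integrated over [0, t].

The test is not allowed as it stands: the flux is cubic in ∇u while ∇u is only square integrable in
time, so u_t is not known to lie in L²(H⁻¹), and the finiteness of ∫‖∇u‖⁴ is itself part of the
claim. The equation is therefore projected on finitely many Dirichlet eigenfunctions. These are
orthogonal both in L² and for the Dirichlet form, and the factor 1 + ‖∇u‖² is a scalar, so the
projection w of u satisfies an exact energy identity with dissipation (1 + ‖∇u‖²)‖∇w‖²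
(`IsWeakSolution.ae_hasDerivAt_modalEnergy`). Fatou's lemma removes the projection and yields the
integrability (`IsWeakSolution.energy_le_of_pos`). Continuity of u in L² then extends the inequality
from almost all positive times to [0, t] (`IsWeakSolution.energy_le`).

The spectral theory comes from the operator S = `solutionOp Ω`, which represents the L² product in
the H¹ product. It is compact by Rellich's theorem (`isCompactOperator_toL2`), proved from a
variance estimate on grid cells. An eigenvalue κ ≠ 0 of S corresponds to the Dirichlet eigenvalue
1/κ - 1, so λ₁ = 1/‖S‖ - 1 (`isLeast_lambda1`). -/

/-! ### Test functions: translation estimate and Poincaré's inequality -/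

/-- The squared increment of a `C¹` function over a segment is at most the integral of its
squared derivative. -/
theorem sq_sub_le_integral_gradient {d : ℕ} {φ : EuclideanSpace ℝ (Fin d) → ℝ}
    (hφ : ContDiff ℝ 1 φ) (x h : EuclideanSpace ℝ (Fin d)) :
    (φ (x + h) - φ x) ^ 2 ≤ ∫ s in (0 : ℝ)..1, ‖h‖ ^ 2 * ‖gradient φ (x + s • h)‖ ^ 2 := by
  have hd : Continuous (fderiv ℝ φ) := hφ.continuous_fderiv (by simp)
  have hg : Continuous (gradient φ) := by
    unfold gradient
    exact (InnerProductSpace.toDual ℝ _).symm.continuous.comp hd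
  have hc : Continuous fun s : ℝ => fderiv ℝ φ (x + s • h) h := by fun_prop
  have hder : ∀ s : ℝ, HasDerivAt (fun s : ℝ => φ (x + s • h)) (fderiv ℝ φ (x + s • h) h) s := by
    intro s
    have h1 : HasDerivAt (fun s : ℝ => x + s • h) h s := by
      simpa using ((hasDerivAt_id s).smul_const h).const_add x
    exact ((hφ.differentiable (by simp)) _).hasFDerivAt.comp_hasDerivAt s h1
  have hftc : ∫ s in (0 : ℝ)..1, fderiv ℝ φ (x + s • h) h = φ (x + h) - φ x := by
    rw [intervalIntegral.integral_eq_sub_of_hasDerivAt (fun s _ => hder s)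
      (hc.intervalIntegrable _ _)]
    simp
  set c := φ (x + h) - φ x
  -- Cauchy–Schwarz on [0, 1] in variance form: c is the mean of the directional derivative.
  have hsq : 0 ≤ ∫ s in (0 : ℝ)..1, (fderiv ℝ φ (x + s • h) h - c) ^ 2 :=
    intervalIntegral.integral_nonneg (by norm_num) fun s _ => sq_nonneg _
  have hexp : ∫ s in (0 : ℝ)..1, (fderiv ℝ φ (x + s • h) h - c) ^ 2
      = (∫ s in (0 : ℝ)..1, (fderiv ℝ φ (x + s • h) h) ^ 2) - c ^ 2 := by
    have : ∀ s : ℝ, (fderiv ℝ φ (x + s • h) h - c) ^ 2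
        = ((fderiv ℝ φ (x + s • h) h) ^ 2 - 2 * c * fderiv ℝ φ (x + s • h) h) + c ^ 2 := by
      intro s; ring
    simp_rw [this]
    rw [intervalIntegral.integral_add, intervalIntegral.integral_sub,
      intervalIntegral.integral_const_mul, hftc]
    · simp; ring
    all_goals exact Continuous.intervalIntegrable (by fun_prop) _ _
  calc c ^ 2 ≤ ∫ s in (0 : ℝ)..1, (fderiv ℝ φ (x + s • h) h) ^ 2 := by linarith
    _ ≤ _ := by
      refine intervalIntegral.integral_mono_on (by norm_num) ?_ ?_ fun s _ => ?_
      · exact Continuous.intervalIntegrable (by fun_prop) _ _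
      · exact Continuous.intervalIntegrable (by fun_prop) _ _
      · have h1 : |fderiv ℝ φ (x + s • h) h| ≤ ‖gradient φ (x + s • h)‖ * ‖h‖ := by
          have := (fderiv ℝ φ (x + s • h)).le_opNorm h
          simpa [gradient] using this
        rw [← sq_abs, ← mul_pow, mul_comm ‖h‖]
        gcongr

theorem IsTestFunction.continuous_gradient {d : ℕ} {Ω : Set (EuclideanSpace ℝ (Fin d))}
    {φ : EuclideanSpace ℝ (Fin d) → ℝ} (hφ : IsTestFunction Ω φ) : Continuous (gradient φ) := by
  unfold gradient
  exact (InnerProductSpace.toDual ℝ _).symm.continuous.comp (hφ.1.continuous_fderiv (by simp))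

theorem IsTestFunction.continuous {d : ℕ} {Ω : Set (EuclideanSpace ℝ (Fin d))}
    {φ : EuclideanSpace ℝ (Fin d) → ℝ} (hφ : IsTestFunction Ω φ) : Continuous φ :=
  hφ.1.continuous

theorem IsTestFunction.eq_zero {d : ℕ} {Ω : Set (EuclideanSpace ℝ (Fin d))}
    {φ : EuclideanSpace ℝ (Fin d) → ℝ} (hφ : IsTestFunction Ω φ)
    {x : EuclideanSpace ℝ (Fin d)} (hx : x ∉ Ω) : φ x = 0 :=
  image_eq_zero_of_notMem_tsupport fun h => hx (hφ.2.2 h)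

theorem IsTestFunction.gradient_eq_zero {d : ℕ} {Ω : Set (EuclideanSpace ℝ (Fin d))}
    {φ : EuclideanSpace ℝ (Fin d) → ℝ} (hφ : IsTestFunction Ω φ)
    {x : EuclideanSpace ℝ (Fin d)} (hx : x ∉ Ω) : gradient φ x = 0 := by
  have : fderiv ℝ φ x = 0 := by
    by_contra h
    exact hx (hφ.2.2 (support_fderiv_subset ℝ h))
  simp [gradient, this]

theorem IsTestFunction.hasCompactSupport_gradient {d : ℕ} {Ω : Set (EuclideanSpace ℝ (Fin d))}
    {φ : EuclideanSpace ℝ (Fin d) → ℝ} (hφ : IsTestFunction Ω φ) :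
    HasCompactSupport (gradient φ) := by
  have := hφ.2.1.fderiv (𝕜 := ℝ)
  unfold gradient
  exact this.comp_left (g := (InnerProductSpace.toDual ℝ _).symm) (map_zero _)

/-- Translation estimate: `‖φ(· + h) - φ‖ ≤ |h| ‖∇φ‖` in `L²`. -/
theorem IsTestFunction.lintegral_sq_translate_sub_le {d : ℕ}
    {Ω : Set (EuclideanSpace ℝ (Fin d))}
    {φ : EuclideanSpace ℝ (Fin d) → ℝ} (hφ : IsTestFunction Ω φ)
    (h : EuclideanSpace ℝ (Fin d)) :
    ∫⁻ x, ENNReal.ofReal ((φ (x + h) - φ x) ^ 2)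
      ≤ ENNReal.ofReal (‖h‖ ^ 2) * ∫⁻ x, ENNReal.ofReal (‖gradient φ x‖ ^ 2) := by
  have hg := hφ.continuous_gradient
  calc ∫⁻ x, ENNReal.ofReal ((φ (x + h) - φ x) ^ 2)
      ≤ ∫⁻ x, ∫⁻ s in Ioc (0 : ℝ) 1,
          ENNReal.ofReal (‖h‖ ^ 2 * ‖gradient φ (x + s • h)‖ ^ 2) := by
        refine lintegral_mono fun x => ?_
        rw [← ofReal_integral_eq_lintegral_ofReal, ← intervalIntegral.integral_of_le zero_le_one]
        · exact ENNReal.ofReal_le_ofReal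
            (sq_sub_le_integral_gradient (hφ.1.of_le (by simp)) x h)
        · have hc : Continuous fun s : ℝ => ‖h‖ ^ 2 * ‖gradient φ (x + s • h)‖ ^ 2 := by fun_prop
          exact (hc.intervalIntegrable 0 1).1
        · exact Filter.Eventually.of_forall fun s => by positivity
    _ = ∫⁻ s in Ioc (0 : ℝ) 1, ∫⁻ x,
          ENNReal.ofReal (‖h‖ ^ 2 * ‖gradient φ (x + s • h)‖ ^ 2) := by
        apply lintegral_lintegral_swap
        apply Measurable.aemeasurable
        apply ENNReal.measurable_ofReal.comp
        apply Continuous.measurable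
        fun_prop
    _ = ∫⁻ s in Ioc (0 : ℝ) 1,
          ENNReal.ofReal (‖h‖ ^ 2) * ∫⁻ x, ENNReal.ofReal (‖gradient φ x‖ ^ 2) := by
        refine lintegral_congr fun s => ?_
        rw [lintegral_add_right_eq_self (μ := volume)
          (fun x => ENNReal.ofReal (‖h‖ ^ 2 * ‖gradient φ x‖ ^ 2)) (s • h)]
        rw [← lintegral_const_mul]
        · simp_rw [ENNReal.ofReal_mul (sq_nonneg ‖h‖)]
        · exact ENNReal.measurable_ofReal.comp (by fun_prop)
    _ = _ := by simp

theorem IsTestFunction.integrable_sq {d : ℕ} {Ω : Set (EuclideanSpace ℝ (Fin d))}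
    {φ : EuclideanSpace ℝ (Fin d) → ℝ} (hφ : IsTestFunction Ω φ) :
    Integrable fun x => φ x ^ 2 := by
  have hc : Continuous fun x => φ x ^ 2 := by have := hφ.continuous; fun_prop
  have hs : HasCompactSupport ((fun y : ℝ => y ^ 2) ∘ φ) := hφ.2.1.comp_left (by simp)
  exact hc.integrable_of_hasCompactSupport hs

theorem IsTestFunction.integrable {d : ℕ} {Ω : Set (EuclideanSpace ℝ (Fin d))}
    {φ : EuclideanSpace ℝ (Fin d) → ℝ} (hφ : IsTestFunction Ω φ) : Integrable φ :=
  hφ.continuous.integrable_of_hasCompactSupport hφ.2.1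

theorem IsTestFunction.integrable_gradient_sq {d : ℕ} {Ω : Set (EuclideanSpace ℝ (Fin d))}
    {φ : EuclideanSpace ℝ (Fin d) → ℝ} (hφ : IsTestFunction Ω φ) :
    Integrable fun x => ‖gradient φ x‖ ^ 2 := by
  have hc : Continuous fun x => ‖gradient φ x‖ ^ 2 := by
    have := hφ.continuous_gradient
    fun_prop
  have hs : HasCompactSupport ((fun y : EuclideanSpace ℝ (Fin d) => ‖y‖ ^ 2) ∘ gradient φ) :=
    hφ.hasCompactSupport_gradient.comp_left (by simp)
  exact hc.integrable_of_hasCompactSupport hs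

/-- Poincaré's inequality for test functions on a bounded set. -/
theorem exists_forall_integral_sq_le {d : ℕ} (hd : d ≠ 0) {Ω : Set (EuclideanSpace ℝ (Fin d))}
    (hΩ : Bornology.IsBounded Ω) :
    ∃ C : ℝ, 0 < C ∧ ∀ φ, IsTestFunction Ω φ → ∫ x, φ x ^ 2 ≤ C * ∫ x, ‖gradient φ x‖ ^ 2 := by
  obtain ⟨R, hR⟩ := Metric.isBounded_iff.1 hΩ
  have : NeZero d := ⟨hd⟩
  have hR1 : 0 < |R| + 1 := by positivity
  set h : EuclideanSpace ℝ (Fin d) := EuclideanSpace.single 0 (|R| + 1) with hh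
  have hn : ‖h‖ = |R| + 1 := by rw [hh, PiLp.norm_single, Real.norm_of_nonneg hR1.le]
  refine ⟨(|R| + 1) ^ 2, by positivity, fun φ hφ => ?_⟩
  -- The shift h is longer than the diameter of Ω, so x and x + h are never both in Ω and the cross
  -- term vanishes. The translation estimate then bounds 2∫φ²; the factor 2 is discarded.
  have key : ∀ x, (φ (x + h) - φ x) ^ 2 = φ (x + h) ^ 2 + φ x ^ 2 := by
    intro x
    by_cases hx : x ∈ Ω
    · have : x + h ∉ Ω := by
        intro hxh
        have h2 := hR hxh hx
        rw [dist_eq_norm, add_sub_cancel_left, hn] at h2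
        linarith [le_abs_self R]
      rw [hφ.eq_zero this]; ring
    · rw [hφ.eq_zero hx]; ring
  have hi : Integrable fun x => φ (x + h) ^ 2 := hφ.integrable_sq.comp_add_right h
  have h1 := hφ.lintegral_sq_translate_sub_le h
  simp_rw [key] at h1
  rw [← ofReal_integral_eq_lintegral_ofReal, ← ofReal_integral_eq_lintegral_ofReal, hn,
    ← ENNReal.ofReal_mul (by positivity), integral_add,
    integral_add_right_eq_self (fun x => φ x ^ 2) h] at h1
  · have h0 : 0 ≤ ∫ x, φ x ^ 2 := integral_nonneg fun x => sq_nonneg _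
    have h3 : 0 ≤ (|R| + 1) ^ 2 * ∫ x, ‖gradient φ x‖ ^ 2 :=
      mul_nonneg (sq_nonneg _) (integral_nonneg fun x => sq_nonneg _)
    have h2 := (ENNReal.ofReal_le_ofReal_iff h3).1 h1
    linarith
  · exact hi
  · exact hφ.integrable_sq
  · exact hφ.integrable_gradient_sq
  · exact Filter.Eventually.of_forall fun s => sq_nonneg _
  · exact hi.add hφ.integrable_sq
  · exact Filter.Eventually.of_forall fun s => add_nonneg (sq_nonneg _) (sq_nonneg _)

/-! ### Grid averages and the L² norm -/

/-- The mean square of the differences `φ x - φ y` is twice the variance of `φ`. -/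
theorem lintegral_lintegral_sq_sub {X : Type*} [MeasurableSpace X] (μ : Measure X)
    [IsFiniteMeasure μ] {φ : X → ℝ} (h1 : Integrable φ μ) (h2 : Integrable (fun x => φ x ^ 2) μ) :
    0 ≤ 2 * μ.real univ * (∫ x, φ x ^ 2 ∂μ) - 2 * (∫ x, φ x ∂μ) ^ 2 ∧
    ∫⁻ x, ∫⁻ y, ENNReal.ofReal ((φ x - φ y) ^ 2) ∂μ ∂μ
      = ENNReal.ofReal (2 * μ.real univ * (∫ x, φ x ^ 2 ∂μ) - 2 * (∫ x, φ x ∂μ) ^ 2) := by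
  have hexp : ∀ x y, (φ x - φ y) ^ 2 = φ x ^ 2 - 2 * φ x * φ y + φ y ^ 2 := fun x y => by ring
  have hinn' : ∀ x, Integrable (fun y => φ x ^ 2 - 2 * φ x * φ y) μ := fun x =>
    (integrable_const _).sub (h1.const_mul _)
  have hinn : ∀ x, Integrable (fun y => (φ x - φ y) ^ 2) μ := by
    intro x
    simp_rw [hexp]
    exact (hinn' x).add h2
  have hval : ∀ x, ∫ y, (φ x - φ y) ^ 2 ∂μ
      = φ x ^ 2 * μ.real univ - 2 * (∫ y, φ y ∂μ) * φ x + ∫ y, φ y ^ 2 ∂μ := by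
    intro x
    simp_rw [hexp]
    rw [integral_add (hinn' x) h2,
      integral_sub (integrable_const _) (h1.const_mul _), integral_const_mul, integral_const,
      smul_eq_mul]
    ring
  have hin : ∀ x, ∫⁻ y, ENNReal.ofReal ((φ x - φ y) ^ 2) ∂μ
      = ENNReal.ofReal (∫ y, (φ x - φ y) ^ 2 ∂μ) := fun x =>
    (ofReal_integral_eq_lintegral_ofReal (hinn x)
      (Filter.Eventually.of_forall fun y => sq_nonneg _)).symm
  simp_rw [hin]
  have hout' : Integrable (fun x => φ x ^ 2 * μ.real univ - 2 * (∫ y, φ y ∂μ) * φ x) μ :=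
    (h2.mul_const _).sub (h1.const_mul _)
  have hout : Integrable (fun x => ∫ y, (φ x - φ y) ^ 2 ∂μ) μ := by
    simp_rw [hval]
    exact hout'.add (integrable_const _)
  have hint : ∫ x, ∫ y, (φ x - φ y) ^ 2 ∂μ ∂μ
      = 2 * μ.real univ * (∫ x, φ x ^ 2 ∂μ) - 2 * (∫ x, φ x ∂μ) ^ 2 := by
    simp_rw [hval]
    rw [integral_add hout' (integrable_const _),
      integral_sub (h2.mul_const _) (h1.const_mul _), integral_const_mul, integral_mul_const,
      integral_const, smul_eq_mul]
    ring
  rw [← hint]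
  exact ⟨integral_nonneg fun x => integral_nonneg fun y => sq_nonneg _,
    (ofReal_integral_eq_lintegral_ofReal hout
      (Filter.Eventually.of_forall fun x => integral_nonneg fun y => sq_nonneg _)).symm⟩

/-- The cell with index `k` of the grid of mesh size `δ`. -/
def gridCell {d : ℕ} (δ : ℝ) (k : Fin d → ℤ) : Set (EuclideanSpace ℝ (Fin d)) :=
  {x | (fun i => ⌊x i / δ⌋) = k}

theorem measurable_gridIndex {d : ℕ} (δ : ℝ) :
    Measurable fun (x : EuclideanSpace ℝ (Fin d)) (i : Fin d) => ⌊x i / δ⌋ := by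
  refine measurable_pi_lambda _ fun i => Int.measurable_floor.comp ?_
  exact (Continuous.measurable (by fun_prop))

theorem measurableSet_gridCell {d : ℕ} (δ : ℝ) (k : Fin d → ℤ) :
    MeasurableSet (gridCell δ k) :=
  measurable_gridIndex δ (measurableSet_singleton k)

theorem pairwise_disjoint_gridCell {d : ℕ} (δ : ℝ) :
    Pairwise (Function.onFun Disjoint (gridCell (d := d) δ)) := by
  intro k l hkl
  refine Set.disjoint_left.2 fun x hk hl => hkl ?_
  exact (show _ = k from hk).symm.trans hl

theorem gridCell_eq_preimage {d : ℕ} {δ : ℝ} (hδ : 0 < δ) (k : Fin d → ℤ) :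
    gridCell δ k = (MeasurableEquiv.toLp 2 (Fin d → ℝ)).symm ⁻¹'
      Set.pi univ fun i => Ico (δ * k i) (δ * k i + δ) := by
  ext x
  simp only [gridCell, mem_ofPred_eq, funext_iff, Int.floor_eq_iff, mem_preimage, mem_pi, mem_univ,
    true_imp_iff, mem_Ico, MeasurableEquiv.coe_toLp_symm]
  refine forall_congr' fun i => ?_
  rw [le_div_iff₀ hδ, div_lt_iff₀ hδ, mul_comm δ, add_mul, one_mul]

theorem volume_gridCell {d : ℕ} {δ : ℝ} (hδ : 0 < δ) (k : Fin d → ℤ) :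
    volume (gridCell δ k) = ENNReal.ofReal (δ ^ d) := by
  rw [gridCell_eq_preimage hδ,
    (EuclideanSpace.volume_preserving_symm_measurableEquiv_toLp (Fin d)).measure_preimage_equiv,
    Real.volume_pi_Ico]
  simp [ENNReal.ofReal_pow hδ.le]

/-- The open cube with centre `0` and side `2δ`. -/
def openCube (d : ℕ) (δ : ℝ) : Set (EuclideanSpace ℝ (Fin d)) := {x | ∀ i, |x i| < δ}

theorem openCube_eq_preimage (d : ℕ) (δ : ℝ) :
    openCube d δ = (MeasurableEquiv.toLp 2 (Fin d → ℝ)).symm ⁻¹'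
      Set.pi univ fun _ => Ioo (-δ) δ := by
  ext x
  simp [openCube, abs_lt]

theorem measurableSet_openCube (d : ℕ) (δ : ℝ) : MeasurableSet (openCube d δ) := by
  rw [openCube_eq_preimage]
  exact (MeasurableEquiv.measurable _) (MeasurableSet.univ_pi fun _ => measurableSet_Ioo)

theorem volume_openCube (d : ℕ) {δ : ℝ} (hδ : 0 < δ) :
    volume (openCube d δ) = ENNReal.ofReal ((2 * δ) ^ d) := by
  rw [openCube_eq_preimage,
    (EuclideanSpace.volume_preserving_symm_measurableEquiv_toLp (Fin d)).measure_preimage_equiv,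
    Real.volume_pi_Ioo]
  simp only [Finset.prod_const, Finset.card_univ, Fintype.card_fin]
  rw [← ENNReal.ofReal_pow (by linarith)]
  congr 2; ring

theorem norm_sq_le_of_mem_openCube {d : ℕ} {δ : ℝ} {h : EuclideanSpace ℝ (Fin d)}
    (hh : h ∈ openCube d δ) : ‖h‖ ^ 2 ≤ d * δ ^ 2 := by
  rw [EuclideanSpace.norm_sq_eq]
  calc ∑ i, ‖h i‖ ^ 2 ≤ ∑ _i : Fin d, δ ^ 2 := by
        gcongr with i
        exact (hh i).le
    _ = _ := by simp

theorem sub_mem_openCube {d : ℕ} {δ : ℝ} (hδ : 0 < δ) {k : Fin d → ℤ}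
    {x y : EuclideanSpace ℝ (Fin d)} (hx : x ∈ gridCell δ k) (hy : y ∈ gridCell δ k) :
    y - x ∈ openCube d δ := by
  rw [gridCell_eq_preimage hδ] at hx hy
  intro i
  have h1 := hx i (mem_univ i)
  have h2 := hy i (mem_univ i)
  simp only [MeasurableEquiv.coe_toLp_symm, mem_Ico] at h1 h2
  rw [PiLp.sub_apply, abs_lt]
  constructor <;> linarith [h1.1, h1.2, h2.1, h2.2]

/-- The squared differences of a test function over pairs of points in a common grid cell. -/
theorem IsTestFunction.sum_lintegral_sq_sub_le {d : ℕ} {Ω : Set (EuclideanSpace ℝ (Fin d))}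
    {φ : EuclideanSpace ℝ (Fin d) → ℝ} (hφ : IsTestFunction Ω φ) {δ : ℝ} (hδ : 0 < δ)
    (F : Finset (Fin d → ℤ)) :
    ∑ k ∈ F, ∫⁻ x in gridCell δ k, ∫⁻ y in gridCell δ k, ENNReal.ofReal ((φ x - φ y) ^ 2)
      ≤ ENNReal.ofReal ((2 * δ) ^ d * (d * δ ^ 2) * ∫ x, ‖gradient φ x‖ ^ 2) := by
  have hc := hφ.continuous
  -- Substituting y = x + h confines h to a cube that does not depend on the cell. The cells then
  -- merge into one integral over x, and Fubini reduces to the translation estimate for fixed h.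
  have hcell : ∀ k, ∀ x ∈ gridCell δ k,
      ∫⁻ y in gridCell δ k, ENNReal.ofReal ((φ x - φ y) ^ 2)
        ≤ ∫⁻ h in openCube d δ, ENNReal.ofReal ((φ (x + h) - φ x) ^ 2) := by
    intro k x hx
    rw [← lintegral_indicator (measurableSet_gridCell δ k),
      ← lintegral_indicator (measurableSet_openCube d δ),
      ← lintegral_add_left_eq_self (μ := volume) _ x]
    refine lintegral_mono fun h => ?_
    by_cases hh : x + h ∈ gridCell δ k
    · have h1 : h ∈ openCube d δ := by simpa using sub_mem_openCube hδ hx hh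
      rw [indicator_of_mem hh, indicator_of_mem h1, ← neg_sub, neg_sq]
    · rw [indicator_of_notMem hh]; exact zero_le
  have hcont : Continuous fun p : EuclideanSpace ℝ (Fin d) × EuclideanSpace ℝ (Fin d) =>
      (φ (p.1 + p.2) - φ p.1) ^ 2 := by fun_prop
  calc ∑ k ∈ F, ∫⁻ x in gridCell δ k, ∫⁻ y in gridCell δ k, ENNReal.ofReal ((φ x - φ y) ^ 2)
      ≤ ∑ k ∈ F, ∫⁻ x in gridCell δ k, ∫⁻ h in openCube d δ,
          ENNReal.ofReal ((φ (x + h) - φ x) ^ 2) := by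
        refine Finset.sum_le_sum fun k _ => ?_
        exact setLIntegral_mono' (measurableSet_gridCell δ k) (hcell k)
    _ = ∫⁻ x in ⋃ k ∈ F, gridCell δ k, ∫⁻ h in openCube d δ,
          ENNReal.ofReal ((φ (x + h) - φ x) ^ 2) := by
        rw [lintegral_biUnion_finset]
        · exact fun k _ l _ hkl => pairwise_disjoint_gridCell δ hkl
        · exact fun k _ => measurableSet_gridCell δ k
    _ ≤ ∫⁻ x, ∫⁻ h in openCube d δ, ENNReal.ofReal ((φ (x + h) - φ x) ^ 2) :=
        setLIntegral_le_lintegral _ _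
    _ = ∫⁻ h in openCube d δ, ∫⁻ x, ENNReal.ofReal ((φ (x + h) - φ x) ^ 2) :=
        lintegral_lintegral_swap (ENNReal.measurable_ofReal.comp hcont.measurable).aemeasurable
    _ ≤ ∫⁻ _h in openCube d δ,
          ENNReal.ofReal (d * δ ^ 2) * ∫⁻ x, ENNReal.ofReal (‖gradient φ x‖ ^ 2) := by
        refine setLIntegral_mono' (measurableSet_openCube d δ) fun h hh => ?_
        refine (hφ.lintegral_sq_translate_sub_le h).trans ?_
        gcongr
        exact norm_sq_le_of_mem_openCube hh
    _ = _ := by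
        rw [setLIntegral_const, volume_openCube d hδ, ← ofReal_integral_eq_lintegral_ofReal
          hφ.integrable_gradient_sq (Filter.Eventually.of_forall fun x => sq_nonneg _),
          ← ENNReal.ofReal_mul (by positivity), ← ENNReal.ofReal_mul' (by positivity)]
        congr 1; ring

/-- Finitely many cells of the grid meet a bounded set. -/
theorem finite_gridIndex_image {d : ℕ} (δ : ℝ) {Ω : Set (EuclideanSpace ℝ (Fin d))}
    (hΩ : Bornology.IsBounded Ω) :
    ((fun (x : EuclideanSpace ℝ (Fin d)) (i : Fin d) => ⌊x i / δ⌋) '' Ω).Finite := by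
  obtain ⟨R, hR⟩ := hΩ.exists_norm_le
  refine (Set.Finite.pi' (t := fun _ : Fin d => Icc ⌊-|R / δ|⌋ ⌊|R / δ|⌋)
    fun i => Set.finite_Icc _ _).subset ?_
  rintro _ ⟨x, hx, rfl⟩ i
  have h1 : |x i / δ| ≤ |R / δ| := by
    rw [abs_div, abs_div]
    have := (PiLp.norm_apply_le x i).trans (hR x hx)
    rw [Real.norm_eq_abs] at this
    refine div_le_div_of_nonneg_right ?_ (abs_nonneg δ)
    exact this.trans (le_abs_self R)
  exact ⟨Int.floor_le_floor (neg_le_of_abs_le h1), Int.floor_le_floor (le_of_abs_le h1)⟩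

/-- Up to a small multiple of the Dirichlet integral, the `L²` norm of a test function on a
bounded set is controlled by finitely many of its averages. -/
theorem exists_forall_integral_sq_le_add {d : ℕ} {Ω : Set (EuclideanSpace ℝ (Fin d))}
    (hΩ : Bornology.IsBounded Ω) {ε : ℝ} (hε : 0 < ε) :
    ∃ (δ : ℝ) (F : Finset (Fin d → ℤ)) (C : ℝ), ∀ φ, IsTestFunction Ω φ →
      ∫ x, φ x ^ 2 ≤ ε * (∫ x, ‖gradient φ x‖ ^ 2)
        + C * ∑ k ∈ F, (∫ x in gridCell δ k, φ x) ^ 2 := by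
  -- The cell estimate needs only 2^d d δ² ≤ 2ε. The d + 1 in the witness keeps δ positive also for
  -- d = 0.
  obtain ⟨δ, hδ, hδε⟩ : ∃ δ : ℝ, 0 < δ ∧ 2 ^ d * d * δ ^ 2 ≤ ε := by
    refine ⟨√(ε / (2 ^ d * (d + 1))), by positivity, ?_⟩
    rw [Real.sq_sqrt (by positivity), mul_div_assoc', div_le_iff₀ (by positivity)]
    nlinarith [mul_pos (pow_pos (zero_lt_two (α := ℝ)) d) hε]
  set F := (finite_gridIndex_image δ hΩ).toFinset with hF
  refine ⟨δ, F, 1 / δ ^ d, fun φ hφ => ?_⟩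
  have hm : 0 < δ ^ d := by positivity
  have hfin : ∀ k : Fin d → ℤ, IsFiniteMeasure (volume.restrict (gridCell δ k)) := fun k =>
    ⟨by rw [Measure.restrict_apply_univ, volume_gridCell hδ]; exact ENNReal.ofReal_lt_top⟩
  have hreal : ∀ k : Fin d → ℤ, (volume.restrict (gridCell δ k)).real univ = δ ^ d := fun k => by
    rw [measureReal_def, Measure.restrict_apply_univ, volume_gridCell hδ,
      ENNReal.toReal_ofReal hm.le]
  -- On each cell the double integral of squared differences is 2δ^d ∫φ² - 2(∫φ)²; summing over the
  -- cells isolates ∫φ².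
  have hvar := fun k : Fin d → ℤ => lintegral_lintegral_sq_sub (volume.restrict (gridCell δ k))
    hφ.integrable.restrict hφ.integrable_sq.restrict
  have hsum := hφ.sum_lintegral_sq_sub_le hδ F
  simp_rw [hreal] at hvar
  simp_rw [fun k => (hvar k).2] at hsum
  have hG : 0 ≤ ∫ x, ‖gradient φ x‖ ^ 2 := integral_nonneg fun x => sq_nonneg _
  rw [← ENNReal.ofReal_sum_of_nonneg fun k _ => (hvar k).1,
    ENNReal.ofReal_le_ofReal_iff (by positivity), Finset.sum_sub_distrib, ← Finset.mul_sum,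
    ← Finset.mul_sum] at hsum
  have htot : ∫ x, φ x ^ 2 = ∑ k ∈ F, ∫ x in gridCell δ k, φ x ^ 2 := by
    rw [← integral_biUnion_finset F (fun k _ => measurableSet_gridCell δ k)
      (fun k _ l _ hkl => pairwise_disjoint_gridCell δ hkl)
      (fun k _ => hφ.integrable_sq.integrableOn)]
    refine (setIntegral_eq_integral_of_forall_compl_eq_zero fun x hx => ?_).symm
    rw [hφ.eq_zero fun hxΩ => hx ?_]
    · simp
    · refine mem_iUnion₂.2 ⟨fun i => ⌊x i / δ⌋, ?_, rfl⟩
      rw [hF, Set.Finite.mem_toFinset]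
      exact ⟨x, hxΩ, rfl⟩
  rw [← htot, mul_pow] at hsum
  have h3 : δ ^ d * ∫ x, φ x ^ 2 ≤ δ ^ d * (ε * ∫ x, ‖gradient φ x‖ ^ 2)
      + ∑ k ∈ F, (∫ x in gridCell δ k, φ x) ^ 2 := by
    have h4 : 2 ^ d * d * δ ^ 2 * (δ ^ d * ∫ x, ‖gradient φ x‖ ^ 2)
        ≤ ε * (δ ^ d * ∫ x, ‖gradient φ x‖ ^ 2) := by gcongr
    have h5 : 0 ≤ ε * (δ ^ d * ∫ x, ‖gradient φ x‖ ^ 2) := by positivity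
    linarith
  refine le_of_mul_le_mul_left (h3.trans_eq ?_) hm
  field_simp

/-! ### Compact operators and Hilbert bases -/

/-- An operator on a Hilbert space that is small on kernels of finite-rank operators is
compact. -/
theorem isCompactOperator_of_forall_exists_ker {X Y : Type*} [NormedAddCommGroup X]
    [InnerProductSpace ℝ X] [CompleteSpace X] [NormedAddCommGroup Y] [NormedSpace ℝ Y]
    [CompleteSpace Y] (T : X →L[ℝ] Y)
    (hT : ∀ ε : ℝ, 0 < ε → ∃ (n : ℕ) (K : X →L[ℝ] (Fin n → ℝ)),
      ∀ v, K v = 0 → ‖T v‖ ≤ ε * ‖v‖) : IsCompactOperator T := by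
  have hcl : IsClosed {A : X →L[ℝ] Y | IsCompactOperator A} := isClosed_setOfPred_isCompactOperator
  refine hcl.closure_subset (Metric.mem_closure_iff.2 fun ε hε => ?_)
  obtain ⟨n, K, hK⟩ := hT (ε / 2) (half_pos hε)
  set N : Submodule ℝ X := K.ker with hN
  have hNc : IsClosed (N : Set X) := K.isClosed_ker
  have : CompleteSpace N := hNc.completeSpace_coe
  have hfd : FiniteDimensional ℝ Nᗮ := by
    refine FiniteDimensional.of_injective (K.toLinearMap.comp Nᗮ.subtype) ?_
    rw [← LinearMap.ker_eq_bot, LinearMap.ker_eq_bot']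
    intro v hv
    have h1 : (v : X) ∈ N := hv
    have h2 := N.inner_right_of_mem_orthogonal h1 v.2
    exact Subtype.ext (inner_self_eq_zero.1 h2)
  -- K is injective on Nᗮ, so this approximant has finite rank; it differs from T by T composed with
  -- the projection on N = ker K, where T is small.
  refine ⟨T ∘L Nᗮ.starProjection, ?_, ?_⟩
  · have : IsCompactOperator (T ∘L Nᗮ.subtypeL) := isCompactOperator_id.continuous_comp (T ∘L Nᗮ.subtypeL).continuous
    exact this.comp_clm Nᗮ.orthogonalProjectionOnto
  · rw [dist_eq_norm]
    refine (ContinuousLinearMap.opNorm_le_bound _ (half_pos hε).le fun v => ?_).trans_lt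
      (half_lt_self hε)
    have h1 : (T - T ∘L Nᗮ.starProjection) v = T (N.starProjection v) := by
      have := N.starProjection_add_starProjection_orthogonal v
      conv_lhs => rw [← this]
      simp
    rw [h1]
    refine (hK _ (N.starProjection_apply_mem v)).trans ?_
    gcongr
    exact N.norm_starProjection_apply_le v

/-- A compact symmetric operator has a Hilbert basis of eigenvectors. -/
theorem exists_hilbertBasis_apply_eq_smul {X : Type u} [NormedAddCommGroup X]
    [InnerProductSpace ℝ X] [CompleteSpace X] {T : X →L[ℝ] X} (hT : IsCompactOperator T)
    (hT' : T.IsSymmetric) :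
    ∃ (ι : Type u) (e : HilbertBasis ι ℝ X) (κ : ι → ℝ), ∀ i, T (e i) = κ i • e i := by
  have hc : ∀ μ : ℝ, CompleteSpace (Module.End.eigenspace (T : Module.End ℝ X) μ) := fun μ => by
    have : IsClosed (Module.End.eigenspace (T : Module.End ℝ X) μ : Set X) := by
      have h1 : (Module.End.eigenspace (T : Module.End ℝ X) μ : Set X) = {x | T x = μ • x} := by
        ext x; simp
      rw [h1]
      exact isClosed_eq T.continuous (continuous_const_smul μ)
    exact this.completeSpace_coe
  choose w b hb using fun μ : ℝ =>
    exists_hilbertBasis ℝ (Module.End.eigenspace (T : Module.End ℝ X) μ)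
  set v : (Σ μ : ℝ, w μ) → X := fun i => (b i.1 i.2 : X) with hv
  have hon : Orthonormal ℝ v :=
    hT'.orthogonalFamily_eigenspaces.orthonormal_sigma_orthonormal
      (v_family := fun μ => b μ) fun μ => (b μ).orthonormal
  have hsp : (Submodule.span ℝ (Set.range v))ᗮ = ⊥ := by
    rw [eq_bot_iff, ← ContinuousLinearMap.orthogonalComplement_iSup_eigenspaces_eq_bot hT hT']
    rw [← Submodule.orthogonal_closure (Submodule.span ℝ (Set.range v))]
    -- By the spectral theorem it suffices that every eigenspace, the kernel included, lies in the
    -- closed span of the chosen vectors: expand in its own basis.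
    refine Submodule.orthogonal_le (iSup_le fun μ x hx => ?_)
    have h2 := (b μ).hasSum_repr ⟨x, hx⟩
    have h3 := h2.mapL (Submodule.subtypeL _)
    refine mem_closure_of_tendsto h3 (Filter.Eventually.of_forall fun s => ?_)
    refine Submodule.sum_mem _ fun i _ => ?_
    rw [map_smul]
    exact Submodule.smul_mem _ _ (Submodule.subset_span ⟨⟨μ, i⟩, rfl⟩)
  refine ⟨_, HilbertBasis.mkOfOrthogonalEqBot hon hsp, fun i => i.1, fun i => ?_⟩
  rw [HilbertBasis.coe_mkOfOrthogonalEqBot]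
  exact Module.End.mem_eigenspace_iff.1 (b i.1 i.2).2

/-- A Hilbert basis of a separable space is countable. -/
theorem countable_of_hilbertBasis {X ι : Type*} [NormedAddCommGroup X]
    [InnerProductSpace ℝ X] [TopologicalSpace.SeparableSpace X] (e : HilbertBasis ι ℝ X) :
    Countable ι := by
  -- Distinct basis vectors are √2 > 1 apart, so these balls are disjoint.
  refine Pairwise.countable_of_isOpen_disjoint (s := fun i => Metric.ball (e i) (1 / 2))
    (fun i j hij => ?_) (fun i => Metric.isOpen_ball) fun i => ⟨e i, by simp⟩
  refine Metric.ball_disjoint_ball ?_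
  have h1 : ‖e i - e j‖ ^ 2 = 2 := by
    rw [norm_sub_sq_real, e.orthonormal.1 i, e.orthonormal.1 j, e.orthonormal.2 hij]
    norm_num
  rw [dist_eq_norm]
  nlinarith [norm_nonneg (e i - e j)]

/-- The norm of a nonzero compact positive operator is an eigenvalue. -/
theorem exists_apply_eq_norm_smul {X : Type*} [NormedAddCommGroup X]
    [InnerProductSpace ℝ X] [CompleteSpace X] {T : X →L[ℝ] X} (hT : IsCompactOperator T)
    (hT' : T.IsSymmetric) (hpos : ∀ v, 0 ≤ ⟪T v, v⟫) (h0 : T ≠ 0) :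
    ∃ v, v ≠ 0 ∧ T v = ‖T‖ • v := by
  have hn : ‖T‖ ≠ 0 := norm_ne_zero_iff.2 h0
  have : Nontrivial X := by
    obtain ⟨v, hv⟩ := DFunLike.ne_iff.1 h0
    exact ⟨v, 0, fun h => hv (by simp [h])⟩
  obtain h | h := hT.hasEigenvalue_or_mem_resolventSet hn
  · obtain ⟨v, hv, hv0⟩ := h.exists_hasEigenvector
    exact ⟨v, hv0, Module.End.mem_eigenspace_iff.1 hv⟩
  -- Otherwise the Rayleigh quotient stays below ‖T‖ by a fixed margin, although for a positive
  -- symmetric operator its supremum is ‖T‖.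
  · obtain ⟨ε, hε, hle⟩ := T.rayleighQuotient_le_of_norm_mem_resolventSet h
    have habs : ∀ x, |T.rayleighQuotient x| = T.rayleighQuotient x := fun x =>
      abs_of_nonneg (div_nonneg (hpos x) (sq_nonneg _))
    have := T.norm_eq_iSup_rayleighQuotient hT'
    simp_rw [habs] at this
    linarith [ciSup_le hle]

/-! ### The space H¹₀(Ω) and Rellich's theorem -/

variable {d : ℕ} {Ω : Set (EuclideanSpace ℝ (Fin d))}

instance : CompleteSpace (H10 Ω) := by
  have : IsClosed (H10 Ω : Set (WithLp 2 (L2 Ω × L2Vec Ω))) :=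
    Submodule.isClosed_topologicalClosure _
  exact this.completeSpace_coe

instance : TopologicalSpace.SeparableSpace (H10 Ω) := by
  have : Fact ((2 : ℝ≥0∞) ≠ (⊤ : ℝ≥0∞)) := ⟨by simp⟩
  have h1 : SecondCountableTopology (L2 Ω) := Lp.SecondCountableTopology
  have h2 : SecondCountableTopology (L2Vec Ω) := Lp.SecondCountableTopology
  have : SecondCountableTopology (WithLp 2 (L2 Ω × L2Vec Ω)) :=
    (WithLp.homeomorphProd 2 _ _).secondCountableTopology
  infer_instance

theorem inner_H10 (v w : H10 Ω) : ⟪v, w⟫ = ⟪toL2 v, toL2 w⟫ + ⟪grad v, grad w⟫ := rfl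

theorem norm_sq_H10 (v : H10 Ω) : ‖v‖ ^ 2 = ‖toL2 v‖ ^ 2 + ‖grad v‖ ^ 2 := by
  simp_rw [← real_inner_self_eq_norm_sq, inner_H10]

/-- A closed property that holds for test functions holds on `H¹₀(Ω)`. -/
theorem H10.induction_of_isClosed {P : H10 Ω → Prop} (hP : IsClosed {v | P v})
    (h : ∀ (v : H10 Ω) (φ : EuclideanSpace ℝ (Fin d) → ℝ), IsTestFunction Ω φ →
      toL2 v =ᵐ[volume.restrict Ω] φ → grad v =ᵐ[volume.restrict Ω] gradient φ → P v)
    (v : H10 Ω) : P v := by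
  have hv : (v : WithLp 2 (L2 Ω × L2Vec Ω)) ∈ closure (testPairs Ω : Set _) := v.2
  have : v ∈ closure ((↑) ⁻¹' (testPairs Ω : Set (WithLp 2 (L2 Ω × L2Vec Ω))) : Set (H10 Ω)) := by
    rw [closure_subtype]
    refine closure_mono (fun p hp => ?_) hv
    exact ⟨⟨p, (testPairs Ω).le_topologicalClosure hp⟩, hp, rfl⟩
  refine hP.closure_subset_iff.2 ?_ this
  rintro w ⟨φ, hφ, h1, h2⟩
  exact h w φ hφ h1 h2

theorem IsTestFunction.setIntegral_sq {φ : EuclideanSpace ℝ (Fin d) → ℝ}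
    (hφ : IsTestFunction Ω φ) : ∫ x in Ω, φ x ^ 2 = ∫ x, φ x ^ 2 :=
  setIntegral_eq_integral_of_forall_compl_eq_zero fun x hx => by simp [hφ.eq_zero hx]

theorem IsTestFunction.setIntegral_gradient_sq {φ : EuclideanSpace ℝ (Fin d) → ℝ}
    (hφ : IsTestFunction Ω φ) : ∫ x in Ω, ‖gradient φ x‖ ^ 2 = ∫ x, ‖gradient φ x‖ ^ 2 :=
  setIntegral_eq_integral_of_forall_compl_eq_zero fun x hx => by simp [hφ.gradient_eq_zero hx]

theorem norm_sq_eq_integral {F : Type*} [NormedAddCommGroup F] [InnerProductSpace ℝ F]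
    {X : Type*} [MeasurableSpace X] {μ : Measure X} (g : Lp F 2 μ) {φ : X → F} (h : g =ᵐ[μ] φ) :
    ‖g‖ ^ 2 = ∫ x, ‖φ x‖ ^ 2 ∂μ := by
  rw [← real_inner_self_eq_norm_sq, L2.inner_def]
  refine integral_congr_ae ?_
  filter_upwards [h] with x hx
  rw [real_inner_self_eq_norm_sq, hx]

theorem IsTestFunction.norm_toL2_sq {φ : EuclideanSpace ℝ (Fin d) → ℝ}
    (hφ : IsTestFunction Ω φ) {v : H10 Ω} (h : toL2 v =ᵐ[volume.restrict Ω] φ) :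
    ‖toL2 v‖ ^ 2 = ∫ x, φ x ^ 2 := by
  rw [norm_sq_eq_integral _ h, ← hφ.setIntegral_sq]
  simp

theorem IsTestFunction.norm_grad_sq {φ : EuclideanSpace ℝ (Fin d) → ℝ}
    (hφ : IsTestFunction Ω φ) {v : H10 Ω} (h : grad v =ᵐ[volume.restrict Ω] gradient φ) :
    ‖grad v‖ ^ 2 = ∫ x, ‖gradient φ x‖ ^ 2 := by
  rw [norm_sq_eq_integral _ h, ← hφ.setIntegral_gradient_sq]

/-- Poincaré's inequality in `H¹₀(Ω)`. -/
theorem exists_norm_toL2_sq_le (hd : d ≠ 0) (hΩ : Bornology.IsBounded Ω) :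
    ∃ C : ℝ, 0 < C ∧ ∀ v : H10 Ω, ‖toL2 v‖ ^ 2 ≤ C * ‖grad v‖ ^ 2 := by
  obtain ⟨C, hC, h⟩ := exists_forall_integral_sq_le hd hΩ
  refine ⟨C, hC, H10.induction_of_isClosed ?_ fun v φ hφ h1 h2 => ?_⟩
  · exact isClosed_le (by fun_prop) (by fun_prop)
  · rw [hφ.norm_toL2_sq h1, hφ.norm_grad_sq h2]
    exact h φ hφ

/-- The integral over `Q ∩ Ω`, as a functional on `L²(Ω)`. -/
theorem exists_setIntegral_functional (hΩ : Bornology.IsBounded Ω)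
    {Q : Set (EuclideanSpace ℝ (Fin d))} (hQ : MeasurableSet Q) :
    ∃ l : L2 Ω →L[ℝ] ℝ, ∀ g : L2 Ω, l g = ∫ x in Q, g x ∂(volume.restrict Ω) := by
  have hfin : (volume.restrict Ω) Q ≠ ⊤ :=
    ((measure_mono (subset_univ Q)).trans_lt (by
      rw [Measure.restrict_apply_univ]; exact hΩ.measure_lt_top)).ne
  refine ⟨innerSL ℝ (indicatorConstLp 2 hQ hfin (1 : ℝ)), fun g => ?_⟩
  rw [innerSL_apply_apply, L2.inner_indicatorConstLp_one]

/-- Rellich's theorem: the embedding of `H¹₀(Ω)` in `L²(Ω)` is compact for bounded `Ω`. -/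
theorem isCompactOperator_toL2 (hΩ : Bornology.IsBounded Ω) :
    IsCompactOperator (toL2 : H10 Ω →L[ℝ] L2 Ω) := by
  refine isCompactOperator_of_forall_exists_ker _ fun ε hε => ?_
  obtain ⟨δ, F, C, h⟩ := exists_forall_integral_sq_le_add hΩ (pow_pos hε 2)
  choose l hl using fun k => exists_setIntegral_functional hΩ (measurableSet_gridCell (d := d) δ k)
  have key : ∀ v : H10 Ω, ‖toL2 v‖ ^ 2 ≤ ε ^ 2 * ‖grad v‖ ^ 2
      + C * ∑ k ∈ F, (l k (toL2 v)) ^ 2 := by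
    refine H10.induction_of_isClosed ?_ fun v φ hφ h1 h2 => ?_
    · exact isClosed_le (by fun_prop) (by fun_prop)
    · rw [hφ.norm_toL2_sq h1, hφ.norm_grad_sq h2]
      refine (h φ hφ).trans_eq ?_
      congr 2
      refine Finset.sum_congr rfl fun k _ => ?_
      rw [hl, setIntegral_congr_ae (g := φ) (measurableSet_gridCell δ k)
        (h1.mono fun x hx _ => hx), Measure.restrict_restrict (measurableSet_gridCell δ k)]
      congr 1
      refine (setIntegral_eq_of_subset_of_forall_sdiff_eq_zero (measurableSet_gridCell δ k)
        inter_subset_left fun x hx => ?_)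
      exact hφ.eq_zero fun hxΩ => hx.2 ⟨hx.1, hxΩ⟩
  -- The finite-rank map collects the cell integrals. On its kernel only the small gradient term of
  -- `key` survives.
  refine ⟨F.card, ContinuousLinearMap.pi fun i => l (F.equivFin.symm i) ∘L toL2, fun v hv => ?_⟩
  have hz : ∀ k ∈ F, l k (toL2 v) = 0 := fun k hk => by
    simpa using congrFun hv (F.equivFin ⟨k, hk⟩)
  have h1 := key v
  rw [Finset.sum_eq_zero fun k hk => by rw [hz k hk, zero_pow two_ne_zero], mul_zero,
    add_zero] at h1
  refine le_of_sq_le_sq ?_ (by positivity)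
  rw [mul_pow]
  refine h1.trans ?_
  have h2 := norm_sq_H10 v
  have h3 : ‖grad v‖ ^ 2 ≤ ‖v‖ ^ 2 := by linarith [sq_nonneg ‖toL2 v‖]
  gcongr

/-! ### The smallest Dirichlet eigenvalue -/

/-- The operator on `H¹₀(Ω)` that represents the `L²` inner product. -/
noncomputable def solutionOp (Ω : Set (EuclideanSpace ℝ (Fin d))) : H10 Ω →L[ℝ] H10 Ω :=
  (toL2 : H10 Ω →L[ℝ] L2 Ω).adjoint ∘L toL2

theorem inner_solutionOp_left (v w : H10 Ω) : ⟪solutionOp Ω v, w⟫ = ⟪toL2 v, toL2 w⟫ := by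
  rw [solutionOp, ContinuousLinearMap.comp_apply, ContinuousLinearMap.adjoint_inner_left]

theorem isSymmetric_solutionOp : (solutionOp Ω).IsSymmetric := fun v w => by
  change ⟪solutionOp Ω v, w⟫ = ⟪v, solutionOp Ω w⟫
  rw [inner_solutionOp_left, real_inner_comm (solutionOp Ω w), inner_solutionOp_left,
    real_inner_comm]

theorem isCompactOperator_solutionOp (hΩ : Bornology.IsBounded Ω) :
    IsCompactOperator (solutionOp Ω) :=
  (isCompactOperator_toL2 hΩ).clm_comp (toL2 : H10 Ω →L[ℝ] L2 Ω).adjoint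

/-- A smooth bump at a point of Ω. It makes `solutionOp Ω` nonzero, so that its norm is a positive
eigenvalue. -/
theorem exists_toL2_ne_zero (hΩ : IsOpen Ω) (hne : Ω.Nonempty) : ∃ v : H10 Ω, toL2 v ≠ 0 := by
  obtain ⟨x, hx⟩ := hne
  obtain ⟨φ, hφs, hφc, hφd, -, hφx⟩ := exists_contDiff_tsupport_subset (n := ⊤) (hΩ.mem_nhds hx)
  have hφ : IsTestFunction Ω φ := ⟨hφd, hφc, hφs⟩
  have hm : MemLp φ 2 (volume.restrict Ω) :=
    (hφ.continuous.memLp_of_hasCompactSupport hφ.2.1).restrict Ω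
  have hm' : MemLp (gradient φ) 2 (volume.restrict Ω) :=
    (hφ.continuous_gradient.memLp_of_hasCompactSupport hφ.hasCompactSupport_gradient).restrict Ω
  let v : H10 Ω := ⟨WithLp.toLp 2 (hm.toLp φ, hm'.toLp (gradient φ)),
    (testPairs Ω).le_topologicalClosure ⟨φ, hφ, hm.coeFn_toLp, hm'.coeFn_toLp⟩⟩
  refine ⟨v, fun h0 => ?_⟩
  have h1 : ∫ y, φ y ^ 2 = 0 := by
    rw [← hφ.norm_toL2_sq (v := v) hm.coeFn_toLp, h0]
    simp
  have h2 : 0 < ∫ y, φ y ^ 2 := by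
    have hc : Continuous fun y => φ y ^ 2 := by have := hφ.continuous; fun_prop
    have hs : HasCompactSupport ((fun y : ℝ => y ^ 2) ∘ φ) := hφ.2.1.comp_left (by simp)
    exact hc.integral_pos_of_hasCompactSupport_nonneg_nonzero hs (fun y => sq_nonneg _)
      (x := x) (by simp [hφx])
  linarith

/-- Cauchy–Schwarz. Once ‖v‖² is split into its two parts, this is Poincaré's inequality with
constant 1/‖S‖ - 1. -/
theorem norm_toL2_sq_le_norm_solutionOp (v : H10 Ω) :
    ‖toL2 v‖ ^ 2 ≤ ‖solutionOp Ω‖ * ‖v‖ ^ 2 := by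
  rw [← real_inner_self_eq_norm_sq (toL2 v), ← inner_solutionOp_left]
  calc ⟪solutionOp Ω v, v⟫ ≤ ‖solutionOp Ω v‖ * ‖v‖ := real_inner_le_norm _ _
    _ ≤ ‖solutionOp Ω‖ * ‖v‖ * ‖v‖ := by gcongr; exact (solutionOp Ω).le_opNorm v
    _ = _ := by ring

/-- The smallest Dirichlet eigenvalue exists, is positive, and is the optimal constant in
Poincaré's inequality. -/
theorem isLeast_lambda1 (hd : d ≠ 0) (hb : Bornology.IsBounded Ω) (ho : IsOpen Ω)
    (hne : Ω.Nonempty) :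
    IsLeast (dirichletEigenvalues Ω) (lambda1 Ω) ∧ 0 < lambda1 Ω ∧
      ∀ v : H10 Ω, lambda1 Ω * ‖toL2 v‖ ^ 2 ≤ ‖grad v‖ ^ 2 := by
  obtain ⟨C, hC, hpoin⟩ := exists_norm_toL2_sq_le hd hb
  have h0 : solutionOp Ω ≠ 0 := by
    obtain ⟨v, hv⟩ := exists_toL2_ne_zero ho hne
    intro h
    have h1 := inner_solutionOp_left v v
    rw [h, zero_apply, inner_zero_left] at h1
    exact hv (inner_self_eq_zero.1 h1.symm)
  obtain ⟨v, hv, hSv⟩ := exists_apply_eq_norm_smul (isCompactOperator_solutionOp hb)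
    isSymmetric_solutionOp
    (fun v => by rw [inner_solutionOp_left]; exact real_inner_self_nonneg) h0
  set κ := ‖solutionOp Ω‖ with hκ
  have hκ0 : 0 < κ := norm_pos_iff (a := solutionOp Ω) |>.2 h0
  have hκv : ∀ w, ⟪toL2 v, toL2 w⟫ = κ * ⟪v, w⟫ := fun w => by
    rw [← inner_solutionOp_left, hSv, real_inner_smul_left]
  have hvp : 0 < ‖v‖ ^ 2 := by have := norm_pos_iff.2 hv; positivity
  -- If κ ≥ 1, then ‖toL2 v‖² ≥ ‖v‖² forces ∇v = 0, and Poincaré's inequality gives v = 0. This is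
  -- what makes λ₁ positive.
  have hκ1 : κ < 1 := by
    by_contra! h
    have h1 := hκv v
    rw [real_inner_self_eq_norm_sq, real_inner_self_eq_norm_sq] at h1
    have h2 := norm_sq_H10 v
    have h3 := hpoin v
    have h4 : ‖v‖ ^ 2 ≤ κ * ‖v‖ ^ 2 := le_mul_of_one_le_left hvp.le h
    have h5 : ‖grad v‖ ^ 2 = 0 := le_antisymm (by linarith) (sq_nonneg _)
    rw [h5, mul_zero] at h3
    linarith
  have hineq : ∀ w : H10 Ω, (1 / κ - 1) * ‖toL2 w‖ ^ 2 ≤ ‖grad w‖ ^ 2 := fun w => by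
    have h1 := norm_toL2_sq_le_norm_solutionOp w
    rw [← hκ, norm_sq_H10 w] at h1
    rw [one_div, sub_mul, one_mul, sub_le_iff_le_add', inv_mul_le_iff₀ hκ0]
    exact h1
  have hleast : IsLeast (dirichletEigenvalues Ω) (1 / κ - 1) := by
    refine ⟨⟨v, hv, fun w => ?_⟩, ?_⟩
    · have h1 := hκv w
      have h2 := inner_H10 v w
      rw [eq_sub_of_add_eq' h2.symm, h1]
      field_simp
    · rintro μ ⟨φ, hφ, h⟩
      have h1 := h φ
      rw [real_inner_self_eq_norm_sq, real_inner_self_eq_norm_sq] at h1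
      -- If the L² part vanished, the eigenvalue relation would make the gradient vanish too, so φ =
      -- 0.
      have h2 : 0 < ‖toL2 φ‖ ^ 2 := by
        refine lt_of_le_of_ne (sq_nonneg _) fun h3 => hφ ?_
        rw [← h3, mul_zero] at h1
        have h4 := norm_sq_H10 φ
        rw [← h3, h1, add_zero] at h4
        simpa using h4
      have h3 := hineq φ
      rw [h1] at h3
      exact le_of_mul_le_mul_right h3 h2
  have hl : lambda1 Ω = 1 / κ - 1 := hleast.csInf_eq
  rw [hl]
  refine ⟨hleast, ?_, hineq⟩
  rw [sub_pos, lt_div_iff₀ hκ0, one_mul]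
  exact hκ1

/-! ### The dual norm -/

/-- A real supremum bounds its terms only if they are bounded above. Poincaré's inequality provides
this, as ‖∇v‖ controls the H¹ norm. If ∇v = 0 the quotient is 0 by convention, and the same bound
gives F v = 0. -/
theorem abs_apply_le_negNorm (hd : d ≠ 0) (hb : Bornology.IsBounded Ω) (F : HNeg1 Ω)
    (v : H10 Ω) : |F v| ≤ negNorm F * ‖grad v‖ := by
  obtain ⟨C, hC, hpoin⟩ := exists_norm_toL2_sq_le hd hb
  have hle : ∀ w : H10 Ω, |F w| ≤ ‖F‖ * √(C + 1) * ‖grad w‖ := fun w => by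
    have h1 : ‖w‖ ≤ √(C + 1) * ‖grad w‖ := by
      refine le_of_sq_le_sq ?_ (by positivity)
      rw [mul_pow, Real.sq_sqrt (by positivity), norm_sq_H10]
      linarith [hpoin w]
    calc |F w| ≤ ‖F‖ * ‖w‖ := F.le_opNorm w
      _ ≤ ‖F‖ * (√(C + 1) * ‖grad w‖) := by gcongr
      _ = _ := by ring
  have hbdd : BddAbove (range fun w : H10 Ω => |F w| / ‖grad w‖) := by
    refine ⟨‖F‖ * √(C + 1), ?_⟩
    rintro _ ⟨w, rfl⟩
    exact div_le_of_le_mul₀ (norm_nonneg _) (by positivity) (hle w)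
  obtain h0 | h0 := (norm_nonneg (grad v)).eq_or_lt
  · have := hle v
    rw [← h0, mul_zero] at this ⊢
    exact this
  · exact (div_le_iff₀ h0).1 (le_ciSup hbdd v)

theorem ae_negNorm_le_lInftyNorm {f : ℝ → HNeg1 Ω} (hf : MemLInftyHNeg1 f) :
    ∀ᵐ t ∂(volume.restrict (Ioi (0 : ℝ))), negNorm (f t) ≤ lInftyNorm f := by
  have h1 := hf.2
  rw [eLpNorm_exponent_top] at h1
  have h2 := ae_le_eLpNormEssSup (f := fun t => negNorm (f t)) (μ := volume.restrict (Ioi (0 : ℝ)))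
  filter_upwards [h2] with t ht
  have h3 := ENNReal.toReal_mono h1.ne ht
  rw [lInftyNorm, eLpNorm_exponent_top]
  rw [toReal_enorm] at h3
  exact (le_abs_self _).trans h3

/-! ### Spectral projections -/

/-- The orthogonal projection on the span of finitely many members of a Hilbert basis. -/
noncomputable def basisProj {ι X : Type*} [NormedAddCommGroup X] [InnerProductSpace ℝ X]
    (e : HilbertBasis ι ℝ X) (s : Finset ι) : X →L[ℝ] X :=
  ∑ i ∈ s, (innerSL ℝ (e i)).smulRight (e i)

theorem basisProj_apply {ι X : Type*} [NormedAddCommGroup X] [InnerProductSpace ℝ X]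
    (e : HilbertBasis ι ℝ X) (s : Finset ι) (v : X) :
    basisProj e s v = ∑ i ∈ s, ⟪e i, v⟫ • e i := by
  simp [basisProj]

theorem tendsto_basisProj {ι X : Type*} [NormedAddCommGroup X] [InnerProductSpace ℝ X]
    (e : HilbertBasis ι ℝ X) (v : X) :
    Filter.Tendsto (fun s => basisProj e s v) Filter.atTop (nhds v) := by
  have h := e.hasSum_repr v
  simp_rw [e.repr_apply_apply] at h
  simp_rw [basisProj_apply]
  exact h

theorem inner_basisProj {ι X : Type*} [NormedAddCommGroup X] [InnerProductSpace ℝ X]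
    (e : HilbertBasis ι ℝ X) {s : Finset ι} (v : X) {j : ι} (hj : j ∈ s) :
    ⟪e j, basisProj e s v⟫ = ⟪e j, v⟫ := by
  classical
  rw [basisProj_apply, inner_sum]
  simp_rw [real_inner_smul_right, orthonormal_iff_ite.1 e.orthonormal]
  simp [hj]

section Eigenbasis

variable {ι : Type*} {e : HilbertBasis ι ℝ (H10 Ω)} {κ : ι → ℝ}

/-- The H¹-orthonormal basis is thereby also orthogonal in L², with weights κ i, and for the
Dirichlet form, with weights 1 - κ i. -/
theorem inner_toL2_eigenvector (he : ∀ i, solutionOp Ω (e i) = κ i • e i) (i : ι) (v : H10 Ω) :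
    ⟪toL2 (e i), toL2 v⟫ = κ i * ⟪e i, v⟫ := by
  rw [← inner_solutionOp_left, he]
  exact real_inner_smul_left (e i) v (κ i)

theorem inner_grad_eigenvector (he : ∀ i, solutionOp Ω (e i) = κ i • e i) (i : ι) (v : H10 Ω) :
    ⟪grad (e i), grad v⟫ = (1 - κ i) * ⟪e i, v⟫ := by
  have := inner_H10 (e i) v
  rw [inner_toL2_eigenvector he] at this
  linarith

/-- The sum is (∇v, ∇w) with w the projection of v, and v - w is orthogonal to w for the Dirichlet
form. It is the diffusion term obtained by testing with w. -/
theorem sum_inner_mul_inner_grad (he : ∀ i, solutionOp Ω (e i) = κ i • e i) (s : Finset ι)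
    (v : H10 Ω) :
    ∑ i ∈ s, ⟪e i, v⟫ * ⟪grad v, grad (e i)⟫ = ‖grad (basisProj e s v)‖ ^ 2 := by
  have h : grad (basisProj e s v) = ∑ i ∈ s, ⟪e i, v⟫ • grad (e i) := by
    rw [basisProj_apply, map_sum]
    exact Finset.sum_congr rfl fun i _ => map_smul _ _ _
  rw [← real_inner_self_eq_norm_sq]
  nth_rewrite 1 [h]
  rw [sum_inner]
  refine Finset.sum_congr rfl fun i hi => ?_
  rw [real_inner_smul_left, real_inner_comm (grad (e i)), inner_grad_eigenvector he,
    inner_grad_eigenvector he, inner_basisProj e v hi]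

theorem sum_inner_sq (he : ∀ i, solutionOp Ω (e i) = κ i • e i) (s : Finset ι) (v : H10 Ω) :
    ∑ i ∈ s, κ i * ⟪e i, v⟫ ^ 2 = ‖toL2 (basisProj e s v)‖ ^ 2 := by
  have h : toL2 (basisProj e s v) = ∑ i ∈ s, ⟪e i, v⟫ • toL2 (e i) := by
    rw [basisProj_apply, map_sum]
    exact Finset.sum_congr rfl fun i _ => map_smul _ _ _
  rw [← real_inner_self_eq_norm_sq]
  nth_rewrite 1 [h]
  rw [sum_inner]
  refine Finset.sum_congr rfl fun i hi => ?_
  rw [real_inner_smul_left, inner_toL2_eigenvector he, inner_basisProj e v hi]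
  ring

/-- Disposes of κ i = 0 without proving that `toL2` is injective. -/
theorem toL2_eigenvector_eq_zero (he : ∀ i, solutionOp Ω (e i) = κ i • e i) {i : ι}
    (hi : κ i = 0) : toL2 (e i) = 0 := by
  have := inner_toL2_eigenvector he i (e i)
  rw [hi, zero_mul] at this
  exact inner_self_eq_zero.1 this

/-- The squared `L²` norm of the projection of `g` on the span of finitely many eigenvectors. -/
noncomputable def modalEnergy (e : HilbertBasis ι ℝ (H10 Ω)) (κ : ι → ℝ) (s : Finset ι)
    (g : L2 Ω) : ℝ :=
  -- The division normalizes, since ‖toL2 (e i)‖² = κ i; a term with κ i = 0 counts as 0.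
  ∑ i ∈ s, ⟪g, toL2 (e i)⟫ ^ 2 / κ i

theorem modalEnergy_toL2 (he : ∀ i, solutionOp Ω (e i) = κ i • e i) (s : Finset ι) (v : H10 Ω) :
    modalEnergy e κ s (toL2 v) = ‖toL2 (basisProj e s v)‖ ^ 2 := by
  rw [← sum_inner_sq he, modalEnergy]
  refine Finset.sum_congr rfl fun i _ => ?_
  rw [real_inner_comm, inner_toL2_eigenvector he]
  obtain h | h := eq_or_ne (κ i) 0
  · simp [h]
  · field_simp

end Eigenbasis

/-! ### Energy inequality between positive times -/

section

variable {ι : Type*} {e : HilbertBasis ι ℝ (H10 Ω)} {κ : ι → ℝ}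
  {f : ℝ → HNeg1 Ω} {u₀ : L2 Ω} {u : ℝ → L2 Ω} {U : ℝ → H10 Ω}

theorem absolutelyContinuousOnInterval_sum {ι : Type*} (s : Finset ι) {g : ι → ℝ → ℝ} {a b : ℝ}
    (hg : ∀ i ∈ s, AbsolutelyContinuousOnInterval (g i) a b) :
    AbsolutelyContinuousOnInterval (fun t => ∑ i ∈ s, g i t) a b := by
  classical
  induction s using Finset.induction_on with
  | empty =>
    simp only [Finset.sum_empty]
    exact (contDiff_const (n := 1)).contDiffOn.absolutelyContinuousOnInterval
  | insert i s hi ih =>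
    simp only [Finset.sum_insert hi]
    exact (hg i (by simp)).fun_add (ih fun j hj => hg j (by simp [hj]))

theorem absolutelyContinuousOnInterval_exp_mul (α a b : ℝ) :
    AbsolutelyContinuousOnInterval (fun t => Real.exp (2 * α * t)) a b := by
  refine ContDiffOn.absolutelyContinuousOnInterval ?_
  exact ContDiff.contDiffOn (by fun_prop)

/-- A finite sum of squares of absolutely continuous functions. This is what allows the
almost-everywhere derivative to be integrated. -/
theorem IsWeakSolution.absolutelyContinuousOnInterval_modalEnergy (hu : IsWeakSolution f u₀ u U)
    (s : Finset ι) (α : ℝ) {a b : ℝ} (ha : 0 < a) (hab : a ≤ b) :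
    AbsolutelyContinuousOnInterval
      (fun t => Real.exp (2 * α * t) * modalEnergy e κ s (u t)) a b := by
  refine (absolutelyContinuousOnInterval_exp_mul α a b).mul ?_
  refine absolutelyContinuousOnInterval_sum s fun i _ => ?_
  have h := hu.absolutelyContinuous (e i) a b ha hab
  have h2 := (h.mul h).const_mul (κ i)⁻¹
  convert h2 using 2 with t
  rw [div_eq_inv_mul, sq]
  rfl

/-- The energy identity for the projection on finitely many eigenvectors. -/
theorem IsWeakSolution.ae_hasDerivAt_modalEnergy (hu : IsWeakSolution f u₀ u U)
    (he : ∀ i, solutionOp Ω (e i) = κ i • e i) (s : Finset ι) :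
    ∀ᵐ t ∂(volume.restrict (Ioi (0 : ℝ))),
      HasDerivAt (fun t => modalEnergy e κ s (u t))
        (2 * (f t (basisProj e s (U t))
          - (1 + ‖grad (U t)‖ ^ 2) * ‖grad (basisProj e s (U t))‖ ^ 2)) t := by
  have h1 : ∀ᵐ t ∂(volume.restrict (Ioi (0 : ℝ))), ∀ i ∈ s, ∃ w : ℝ,
      HasDerivAt (fun s => ⟪u s, toL2 (e i)⟫) w t ∧
      w + (1 + ‖grad (U t)‖ ^ 2) * ⟪grad (U t), grad (e i)⟫ = f t (e i) :=
    (Filter.eventually_all_finset s).2 fun i _ => hu.equation (e i)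
  filter_upwards [h1, hu.toL2_ae_eq] with t h1 h2
  choose! w hw hweq using h1
  have hder : HasDerivAt (fun t => modalEnergy e κ s (u t))
      (∑ i ∈ s, 2 * ⟪u t, toL2 (e i)⟫ * w i / κ i) t := by
    refine HasDerivAt.fun_sum fun i hi => ?_
    have h := ((hw i hi).fun_pow 2).div_const (κ i)
    simp only [Nat.cast_ofNat, Nat.add_one_sub_one, pow_one] at h
    exact h
  convert hder using 1
  have hterm : ∀ i ∈ s, 2 * ⟪u t, toL2 (e i)⟫ * w i / κ i = 2 * (⟪e i, U t⟫ * w i) := by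
    intro i hi
    -- For κ i = 0 the tested function is identically 0, so w i = 0; otherwise (u, e i) = κ i ⟪e i,
    -- U⟫ cancels the denominator.
    obtain h0 | h0 := eq_or_ne (κ i) 0
    · have hz := toL2_eigenvector_eq_zero he h0
      have hwi := hw i hi
      simp only [hz, inner_zero_right] at hwi
      rw [hwi.unique (hasDerivAt_const t (0 : ℝ))]
      simp
    · rw [← h2, real_inner_comm, inner_toL2_eigenvector he]
      field_simp
  rw [Finset.sum_congr rfl hterm, ← Finset.mul_sum, ← sum_inner_mul_inner_grad he,
    basisProj_apply, map_sum, Finset.mul_sum, ← Finset.sum_sub_distrib]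
  congr 1
  refine Finset.sum_congr rfl fun i hi => ?_
  rw [eq_sub_of_add_eq (hweq i hi), map_smul, smul_eq_mul]
  ring

/-- The weighted dissipation of the projection `w` of `v = u(t)`. -/
noncomputable def dissipation (α β t : ℝ) (v w : H10 Ω) : ℝ :=
  Real.exp (2 * α * t) * (β * ‖grad w‖ ^ 2 + 2 * ‖grad v‖ ^ 2 * ‖grad w‖ ^ 2)

theorem dissipation_nonneg {β : ℝ} (hβ : 0 ≤ β) (α t : ℝ) (v w : H10 Ω) :
    0 ≤ dissipation α β t v w := by
  unfold dissipation; positivity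

theorem aestronglyMeasurable_dissipation (α β : ℝ) (A : H10 Ω →L[ℝ] H10 Ω) {a b : ℝ} (ha : 0 ≤ a)
    (hab : a ≤ b) (hu : IsWeakSolution f u₀ u U) :
    AEStronglyMeasurable (fun t => dissipation α β t (U t) (A (U t)))
      (volume.restrict (Ioc a b)) := by
  have hU : AEStronglyMeasurable U (volume.restrict (Ioc a b)) := by
    refine (hu.memLp (b + 1) (by linarith)).1.mono_measure (Measure.restrict_mono ?_ le_rfl)
    exact fun t ht => ⟨ha.trans_lt ht.1, ht.2.trans_lt (by linarith)⟩
  have hc : Continuous fun p : ℝ × H10 Ω => dissipation α β p.1 p.2 (A p.2) := by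
    unfold dissipation
    fun_prop
  exact hc.comp_aestronglyMeasurable (aestronglyMeasurable_id.prodMk hU)

/-- The energy inequality for the projection on finitely many eigenvectors. -/
theorem IsWeakSolution.modalEnergy_le (hu : IsWeakSolution f u₀ u U)
    (he : ∀ i, solutionOp Ω (e i) = κ i • e i) (s : Finset ι) {N l α : ℝ}
    (hN : ∀ᵐ t ∂(volume.restrict (Ioi (0 : ℝ))), ∀ v, |f t v| ≤ N * ‖grad v‖)
    (hl0 : 0 < l) (hl : ∀ v : H10 Ω, l * ‖toL2 v‖ ^ 2 ≤ ‖grad v‖ ^ 2) (hα : 0 < α)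
    (hαl : α < l / 2) {a b : ℝ} (ha : 0 < a) (hab : a ≤ b) :
    IntegrableOn (fun t => dissipation α (1 - 2 * α / l) t (U t) (basisProj e s (U t)))
      (Ioc a b) ∧
    Real.exp (2 * α * b) * modalEnergy e κ s (u b)
        + ∫ t in a..b, dissipation α (1 - 2 * α / l) t (U t) (basisProj e s (U t))
      ≤ Real.exp (2 * α * a) * modalEnergy e κ s (u a)
        + N ^ 2 / (2 * α) * (Real.exp (2 * α * b) - Real.exp (2 * α * a)) := by
  have hβ : 0 ≤ 1 - 2 * α / l := by
    rw [sub_nonneg, div_le_one hl0]; linarith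
  set D := fun t => dissipation α (1 - 2 * α / l) t (U t) (basisProj e s (U t)) with hD
  set g := fun t => Real.exp (2 * α * t) * modalEnergy e κ s (u t) with hg
  have hac : AbsolutelyContinuousOnInterval g a b :=
    hu.absolutelyContinuousOnInterval_modalEnergy s α ha hab
  have hae : ∀ᵐ t ∂(volume.restrict (Ioc a b)), D t ≤ N ^ 2 * Real.exp (2 * α * t) - deriv g t := by
    have hsub : Ioc a b ⊆ Ioi (0 : ℝ) := fun t ht => ha.trans ht.1
    filter_upwards [ae_restrict_of_ae_restrict_of_subset hsub (hu.ae_hasDerivAt_modalEnergy he s),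
      ae_restrict_of_ae_restrict_of_subset hsub hN,
      ae_restrict_of_ae_restrict_of_subset hsub hu.toL2_ae_eq] with t h1 h2 h3
    have hexp : HasDerivAt (fun t : ℝ => Real.exp (2 * α * t))
        (Real.exp (2 * α * t) * (2 * α)) t := by
      simpa using ((hasDerivAt_id t).const_mul (2 * α)).exp
    have hder : HasDerivAt g _ t := hexp.mul h1
    rw [hder.deriv, ← h3, modalEnergy_toL2 he]
    set w := basisProj e s (U t)
    -- Young's inequality spends one of the two copies of ‖∇w‖² in the identity. Poincaré's
    -- inequality spends 2α/l of the other, leaving 1 - 2α/l.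
    have h4 : 2 * f t w ≤ N ^ 2 + ‖grad w‖ ^ 2 := by
      have := (le_abs_self _).trans (h2 w)
      nlinarith [sq_nonneg (N - ‖grad w‖)]
    have h5 : 2 * α * ‖toL2 w‖ ^ 2 ≤ 2 * α / l * ‖grad w‖ ^ 2 := by
      rw [div_mul_eq_mul_div, le_div_iff₀ hl0, mul_assoc, mul_comm _ l]
      exact mul_le_mul_of_nonneg_left (hl w) (by positivity)
    have h6 : (1 - 2 * α / l) * ‖grad w‖ ^ 2 + 2 * ‖grad (U t)‖ ^ 2 * ‖grad w‖ ^ 2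
        ≤ N ^ 2 - 2 * α * ‖toL2 w‖ ^ 2
          - 2 * (f t w - (1 + ‖grad (U t)‖ ^ 2) * ‖grad w‖ ^ 2) := by
      linarith
    have h7 := mul_le_mul_of_nonneg_left h6 (Real.exp_pos (2 * α * t)).le
    simp only [hD, dissipation]
    linarith
  have hint1 : IntervalIntegrable (fun t => N ^ 2 * Real.exp (2 * α * t)) volume a b :=
    Continuous.intervalIntegrable (by fun_prop) _ _
  have hint2 := hint1.sub hac.intervalIntegrable_deriv
  -- Integrability is read off from the bound: D is nonnegative and dominated by N²e^{2αt} - g',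
  -- where g' is integrable because g is absolutely continuous.
  have hDint : IntegrableOn D (Ioc a b) := by
    refine hint2.1.mono' (aestronglyMeasurable_dissipation α _ _ ha.le hab hu) ?_
    filter_upwards [hae] with t ht
    rw [Real.norm_of_nonneg (dissipation_nonneg hβ _ _ _ _)]
    exact ht
  refine ⟨hDint, ?_⟩
  have hle : ∫ t in a..b, D t ≤ ∫ t in a..b, (N ^ 2 * Real.exp (2 * α * t) - deriv g t) := by
    rw [intervalIntegral.integral_of_le hab, intervalIntegral.integral_of_le hab]
    exact integral_mono_ae hDint hint2.1 hae
  rw [intervalIntegral.integral_sub hint1 hac.intervalIntegrable_deriv,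
    hac.integral_deriv_eq_sub, intervalIntegral.integral_const_mul] at hle
  have hexp : ∫ t in a..b, Real.exp (2 * α * t)
      = (Real.exp (2 * α * b) - Real.exp (2 * α * a)) / (2 * α) := by
    rw [intervalIntegral.integral_comp_mul_left (f := Real.exp) (c := 2 * α) (by positivity),
      integral_exp, smul_eq_mul, inv_mul_eq_div]
  rw [hexp] at hle
  have : N ^ 2 / (2 * α) * (Real.exp (2 * α * b) - Real.exp (2 * α * a))
      = N ^ 2 * ((Real.exp (2 * α * b) - Real.exp (2 * α * a)) / (2 * α)) := by ring
  rw [this]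
  linarith

/-- The energy inequality between two times at which `u` belongs to `H¹₀(Ω)`. -/
theorem IsWeakSolution.energy_le_of_pos [Countable ι] (hu : IsWeakSolution f u₀ u U)
    (he : ∀ i, solutionOp Ω (e i) = κ i • e i) {N l α : ℝ}
    (hN : ∀ᵐ t ∂(volume.restrict (Ioi (0 : ℝ))), ∀ v, |f t v| ≤ N * ‖grad v‖)
    (hl0 : 0 < l) (hl : ∀ v : H10 Ω, l * ‖toL2 v‖ ^ 2 ≤ ‖grad v‖ ^ 2) (hα : 0 < α)
    (hαl : α < l / 2) {a b : ℝ} (ha : 0 < a) (hab : a ≤ b)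
    (hua : toL2 (U a) = u a) (hub : toL2 (U b) = u b) :
    IntegrableOn (fun t => dissipation α (1 - 2 * α / l) t (U t) (U t)) (Ioc a b) ∧
    Real.exp (2 * α * b) * ‖u b‖ ^ 2
        + ∫ t in a..b, dissipation α (1 - 2 * α / l) t (U t) (U t)
      ≤ Real.exp (2 * α * a) * ‖u a‖ ^ 2
        + N ^ 2 / (2 * α) * (Real.exp (2 * α * b) - Real.exp (2 * α * a)) := by
  have hβ : 0 ≤ 1 - 2 * α / l := by
    rw [sub_nonneg, div_le_one hl0]; linarith
  have hs := fun s => hu.modalEnergy_le he s hN hl0 hl hα hαl ha hab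
  have hlim : ∀ t, toL2 (U t) = u t →
      Filter.Tendsto (fun s => modalEnergy e κ s (u t)) Filter.atTop (nhds (‖u t‖ ^ 2)) := by
    intro t ht
    simp_rw [← ht, modalEnergy_toL2 he]
    exact ((toL2.continuous.tendsto _).comp (tendsto_basisProj e (U t))).norm.pow 2
  set R := Real.exp (2 * α * a) * ‖u a‖ ^ 2
    + N ^ 2 / (2 * α) * (Real.exp (2 * α * b) - Real.exp (2 * α * a))
    - Real.exp (2 * α * b) * ‖u b‖ ^ 2 with hR
  have hRlim : Filter.Tendsto (fun s => Real.exp (2 * α * a) * modalEnergy e κ s (u a)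
      + N ^ 2 / (2 * α) * (Real.exp (2 * α * b) - Real.exp (2 * α * a))
      - Real.exp (2 * α * b) * modalEnergy e κ s (u b)) Filter.atTop (nhds R) :=
    (((hlim a hua).const_mul _).add_const _).sub ((hlim b hub).const_mul _)
  have hDs : ∀ s : Finset ι,
      ∫ t in Ioc a b, dissipation α (1 - 2 * α / l) t (U t) (basisProj e s (U t))
        ≤ Real.exp (2 * α * a) * modalEnergy e κ s (u a)
          + N ^ 2 / (2 * α) * (Real.exp (2 * α * b) - Real.exp (2 * α * a))
          - Real.exp (2 * α * b) * modalEnergy e κ s (u b) := fun s => by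
    have := (hs s).2
    rw [intervalIntegral.integral_of_le hab] at this
    linarith
  have hR0 : 0 ≤ R := ge_of_tendsto' hRlim fun s =>
    (integral_nonneg fun t => dissipation_nonneg hβ _ _ _ _).trans (hDs s)
  -- Nothing is known yet about the integrability of ‖∇u‖⁴, which rules out dominated convergence;
  -- Fatou's lemma gives finiteness and the bound at once.
  have hfatou : ∫⁻ t in Ioc a b, ENNReal.ofReal (dissipation α (1 - 2 * α / l) t (U t) (U t))
      ≤ ENNReal.ofReal R := by
    have hpt : ∀ t, Filter.Tendsto (fun s => ENNReal.ofReal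
        (dissipation α (1 - 2 * α / l) t (U t) (basisProj e s (U t)))) Filter.atTop
        (nhds (ENNReal.ofReal (dissipation α (1 - 2 * α / l) t (U t) (U t)))) := by
      intro t
      refine ENNReal.tendsto_ofReal ?_
      have hc : Continuous fun w => dissipation α (1 - 2 * α / l) t (U t) w := by
        unfold dissipation; fun_prop
      exact (hc.tendsto _).comp (tendsto_basisProj e (U t))
    calc ∫⁻ t in Ioc a b, ENNReal.ofReal (dissipation α (1 - 2 * α / l) t (U t) (U t))
        = ∫⁻ t in Ioc a b, Filter.liminf (fun s => ENNReal.ofReal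
            (dissipation α (1 - 2 * α / l) t (U t) (basisProj e s (U t)))) Filter.atTop :=
          lintegral_congr fun t => (hpt t).liminf_eq.symm
      _ ≤ Filter.liminf (fun s => ∫⁻ t in Ioc a b, ENNReal.ofReal
            (dissipation α (1 - 2 * α / l) t (U t) (basisProj e s (U t)))) Filter.atTop := by
          -- Countability of the basis enters here: Fatou's lemma along finite index sets needs a
          -- countably generated filter.
          refine lintegral_liminf_le' fun s => ?_
          exact (hs s).1.1.aemeasurable.ennreal_ofReal
      _ ≤ Filter.liminf (fun s => ENNReal.ofReal (Real.exp (2 * α * a) * modalEnergy e κ s (u a)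
            + N ^ 2 / (2 * α) * (Real.exp (2 * α * b) - Real.exp (2 * α * a))
            - Real.exp (2 * α * b) * modalEnergy e κ s (u b))) Filter.atTop := by
          refine Filter.liminf_le_liminf (Filter.Eventually.of_forall fun s => ?_)
          rw [← ofReal_integral_eq_lintegral_ofReal (hs s).1
            (Filter.Eventually.of_forall fun t => dissipation_nonneg hβ _ _ _ _)]
          exact ENNReal.ofReal_le_ofReal (hDs s)
      _ = ENNReal.ofReal R := (ENNReal.tendsto_ofReal hRlim).liminf_eq
  have hmeas := aestronglyMeasurable_dissipation α (1 - 2 * α / l)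
    (ContinuousLinearMap.id ℝ (H10 Ω)) ha.le hab hu
  have hDint : IntegrableOn (fun t => dissipation α (1 - 2 * α / l) t (U t) (U t)) (Ioc a b) := by
    refine ⟨hmeas, ?_⟩
    rw [hasFiniteIntegral_iff_ofReal
      (Filter.Eventually.of_forall fun t => dissipation_nonneg hβ _ _ _ _)]
    exact hfatou.trans_lt ENNReal.ofReal_lt_top
  refine ⟨hDint, ?_⟩
  rw [← ofReal_integral_eq_lintegral_ofReal hDint
    (Filter.Eventually.of_forall fun t => dissipation_nonneg hβ _ _ _ _),
    ENNReal.ofReal_le_ofReal_iff hR0, ← intervalIntegral.integral_of_le hab] at hfatou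
  linarith

end

/-! ### Passage to the whole interval [0, t] -/

theorem IsConvexPolytopalDomain.isOpen (hΩ : IsConvexPolytopalDomain Ω) : IsOpen Ω := by
  obtain ⟨-, s, rfl⟩ := hΩ
  exact isOpen_interior

theorem IsConvexPolytopalDomain.isBounded (hΩ : IsConvexPolytopalDomain Ω) :
    Bornology.IsBounded Ω := by
  obtain ⟨-, s, rfl⟩ := hΩ
  exact ((isBounded_convexHull.2 s.finite_toSet.isBounded)).subset interior_subset

/-- A property that holds almost everywhere holds along a sequence decreasing to any given
point. -/
theorem exists_seq_tendsto_of_ae {P : ℝ → Prop}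
    (hP : ∀ᵐ t ∂(volume.restrict (Ioi (0 : ℝ))), P t) {t : ℝ} (ht : 0 ≤ t) :
    ∃ b : ℕ → ℝ, (∀ n, t < b n ∧ P (b n)) ∧ Filter.Tendsto b Filter.atTop (nhds t) := by
  have hex : ∀ n : ℕ, ∃ b, t < b ∧ b < t + 1 / (n + 1) ∧ P b := by
    intro n
    have hpos : (0 : ℝ) < 1 / (n + 1) := Nat.one_div_pos_of_nat
    by_contra! h
    have hnull : volume (Ioo t (t + 1 / ((n : ℝ) + 1))) = 0 := by
      rw [ae_restrict_iff' measurableSet_Ioi] at hP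
      refine measure_mono_null (fun b hb => ?_) (ae_iff.1 hP)
      exact fun hc => h b hb.1 hb.2 (hc (ht.trans_lt hb.1))
    rw [Real.volume_Ioo, ENNReal.ofReal_eq_zero] at hnull
    linarith
  choose b hb1 hb2 hb3 using hex
  refine ⟨b, fun n => ⟨hb1 n, hb3 n⟩, ?_⟩
  refine tendsto_of_tendsto_of_tendsto_of_le_of_le tendsto_const_nhds ?_ (fun n => (hb1 n).le)
    fun n => (hb2 n).le
  simpa using tendsto_one_div_add_atTop_nhds_zero_nat.const_add t

variable {f : ℝ → HNeg1 Ω} {u₀ : L2 Ω} {u : ℝ → L2 Ω} {U : ℝ → H10 Ω}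

theorem IsWeakSolution.tendsto_seq (hu : IsWeakSolution f u₀ u U) {t : ℝ} (ht : 0 ≤ t)
    {b : ℕ → ℝ} (hb : ∀ n, t < b n) (hlim : Filter.Tendsto b Filter.atTop (nhds t)) :
    Filter.Tendsto (fun n => ‖u (b n)‖ ^ 2) Filter.atTop (nhds (‖u t‖ ^ 2)) := by
  refine Filter.Tendsto.pow (Filter.Tendsto.norm ?_) 2
  refine (hu.continuousOn t ht).tendsto.comp (tendsto_nhdsWithin_iff.2 ⟨hlim, ?_⟩)
  exact Filter.Eventually.of_forall fun n => ht.trans (hb n).le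

/-- The energy inequality on `[0, t]`. -/
theorem IsWeakSolution.energy_le (hb : Bornology.IsBounded Ω) (hu : IsWeakSolution f u₀ u U)
    {N l α : ℝ} (hN : ∀ᵐ t ∂(volume.restrict (Ioi (0 : ℝ))), ∀ v, |f t v| ≤ N * ‖grad v‖)
    (hl0 : 0 < l) (hl : ∀ v : H10 Ω, l * ‖toL2 v‖ ^ 2 ≤ ‖grad v‖ ^ 2) (hα : 0 < α)
    (hαl : α < l / 2) {t : ℝ} (ht : 0 ≤ t) :
    IntegrableOn (fun t => dissipation α (1 - 2 * α / l) t (U t) (U t)) (Ioc 0 t) ∧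
    Real.exp (2 * α * t) * ‖u t‖ ^ 2
        + ∫ s in (0 : ℝ)..t, dissipation α (1 - 2 * α / l) s (U s) (U s)
      ≤ ‖u₀‖ ^ 2 + N ^ 2 / (2 * α) * (Real.exp (2 * α * t) - 1) := by
  obtain ⟨ι, e, κ, he⟩ := exists_hilbertBasis_apply_eq_smul (isCompactOperator_solutionOp hb)
    isSymmetric_solutionOp
  have : Countable ι := countable_of_hilbertBasis e
  have hβ : 0 ≤ 1 - 2 * α / l := by
    rw [sub_nonneg, div_le_one hl0]; linarith
  set D := fun t => dissipation α (1 - 2 * α / l) t (U t) (U t) with hD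
  have hD0 : ∀ s, 0 ≤ D s := fun s => dissipation_nonneg hβ _ _ _ _
  have hexpc : Continuous fun t : ℝ => Real.exp (2 * α * t) := by fun_prop
  -- First the right endpoint is a time at which u lies in H¹₀(Ω), and the left one decreases to 0
  -- through such times.
  have step : ∀ b, 0 < b → toL2 (U b) = u b → IntegrableOn D (Ioc 0 b) ∧
      Real.exp (2 * α * b) * ‖u b‖ ^ 2 + ∫ s in (0 : ℝ)..b, D s
        ≤ ‖u₀‖ ^ 2 + N ^ 2 / (2 * α) * (Real.exp (2 * α * b) - 1) := by
    intro b hb0 hub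
    obtain ⟨a, ha, halim⟩ := exists_seq_tendsto_of_ae hu.toL2_ae_eq le_rfl
    have hev : ∀ᶠ n in Filter.atTop, a n ≤ b :=
      (halim.eventually_lt_const hb0).mono fun n hn => hn.le
    have hen : ∀ᶠ n in Filter.atTop, _ := hev.mono fun n hn =>
      hu.energy_le_of_pos he hN hl0 hl hα hαl (ha n).1 hn (ha n).2 hub
    set K : ℕ → ℝ := fun n => Real.exp (2 * α * a n) * ‖u (a n)‖ ^ 2
        + N ^ 2 / (2 * α) * (Real.exp (2 * α * b) - Real.exp (2 * α * a n))
        - Real.exp (2 * α * b) * ‖u b‖ ^ 2 with hK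
    have hKlim : Filter.Tendsto K Filter.atTop (nhds (‖u₀‖ ^ 2
        + N ^ 2 / (2 * α) * (Real.exp (2 * α * b) - 1) - Real.exp (2 * α * b) * ‖u b‖ ^ 2)) := by
      have h1 : Filter.Tendsto (fun n => Real.exp (2 * α * a n)) Filter.atTop (nhds 1) := by
        simpa [Function.comp_def] using (hexpc.tendsto 0).comp halim
      have h2 := hu.tendsto_seq le_rfl (fun n => (ha n).1) halim
      rw [hu.initial] at h2
      have h3 := (((h1.mul h2).add ((h1.const_sub (Real.exp (2 * α * b))).const_mul
        (N ^ 2 / (2 * α)))).sub_const (Real.exp (2 * α * b) * ‖u b‖ ^ 2))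
      rwa [one_mul] at h3
    have hint : IntegrableOn D (Ioc 0 b) := by
      set J := ‖u₀‖ ^ 2 + N ^ 2 / (2 * α) * (Real.exp (2 * α * b) - 1)
        - Real.exp (2 * α * b) * ‖u b‖ ^ 2 with hJ
      have hmeas := aestronglyMeasurable_dissipation α (1 - 2 * α / l)
        (ContinuousLinearMap.id ℝ (H10 Ω)) le_rfl hb0.le hu
      obtain ⟨n₀, hn₀⟩ := Filter.eventually_atTop.1 hen
      have hsub : Filter.Tendsto (fun n => a (n + n₀)) Filter.atTop (nhds 0) :=
        halim.comp (Filter.tendsto_add_atTop_nat n₀)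
      -- The integrals over (a n, b] are at most K n, which tends to J, hence eventually below J +
      -- 1. The shift by n₀ is needed because integrability must hold for every index of the
      -- sequence.
      refine integrableOn_Ioc_of_intervalIntegral_norm_bounded_left (I := J + 1)
        (a := fun n => a (n + n₀)) (l := Filter.atTop)
        (fun n => (hn₀ (n + n₀) (by omega)).1) hsub ?_
      have h5 := (hKlim.eventually_lt_const (lt_add_one J)).and (hen.and hev)
      filter_upwards [(Filter.tendsto_add_atTop_nat n₀).eventually h5] with n hn
      simp_rw [Real.norm_of_nonneg (hD0 _)]
      have h6 := hn.2.1.2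
      rw [intervalIntegral.integral_of_le hn.2.2] at h6
      have h7 := hn.1
      simp only [hK] at h7
      linarith
    refine ⟨hint, ?_⟩
    have hii : IntervalIntegrable D volume 0 b :=
      (intervalIntegrable_iff_integrableOn_Ioc_of_le hb0.le).2 hint
    have hprim : Filter.Tendsto (fun n => ∫ s in (a n)..b, D s) Filter.atTop
        (nhds (∫ s in (0 : ℝ)..b, D s)) := by
      have hcont := intervalIntegral.continuousOn_primitive_interval_left
        (f := D) (μ := volume) (a := 0) (b := b)
        (by rw [uIcc_of_le hb0.le, integrableOn_Icc_iff_integrableOn_Ioc]; exact hint)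
      refine (hcont 0 left_mem_uIcc).tendsto.comp (tendsto_nhdsWithin_iff.2 ⟨halim, ?_⟩)
      filter_upwards [hev] with n hn
      rw [uIcc_of_le hb0.le]
      exact ⟨(ha n).1.le, hn⟩
    have := le_of_tendsto_of_tendsto hprim hKlim (hen.mono fun n hn => by
      have := hn.2
      simp only [hK]
      linarith)
    linarith
  -- An arbitrary t is reached from the right: the dissipation over [0, t] is at most that over [0,
  -- b n], and the other terms converge.
  obtain ⟨b, hb, hblim⟩ := exists_seq_tendsto_of_ae hu.toL2_ae_eq ht
  have hst := fun n => step (b n) (ht.trans_lt (hb n).1) (hb n).2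
  have hint : IntegrableOn D (Ioc 0 t) := (hst 0).1.mono_set (Ioc_subset_Ioc_right (hb 0).1.le)
  refine ⟨hint, ?_⟩
  have hexpl : Filter.Tendsto (fun n => Real.exp (2 * α * b n)) Filter.atTop
      (nhds (Real.exp (2 * α * t))) := (hexpc.tendsto t).comp hblim
  have hul := hu.tendsto_seq ht (fun n => (hb n).1) hblim
  refine le_of_tendsto_of_tendsto' ((hexpl.mul hul).add_const _)
    (((hexpl.sub_const 1).const_mul (N ^ 2 / (2 * α))).const_add (‖u₀‖ ^ 2)) fun n => ?_
  refine le_trans ?_ (hst n).2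
  gcongr
  rw [intervalIntegral.integral_of_le ht,
    intervalIntegral.integral_of_le (ht.trans (hb n).1.le)]
  exact setIntegral_mono_set (hst n).1 (Filter.Eventually.of_forall hD0)
    (Ioc_subset_Ioc_right (hb n).1.le).eventuallyLE

end KirchhoffParabolic

/-! ### The theorem -/

open KirchhoffParabolic
theorem lemma2p1 {d : ℕ} (hd : d = 2 ∨ d = 3) (Ω : Set (EuclideanSpace ℝ (Fin d)))
    (hΩ : IsConvexPolytopalDomain Ω)
    (f : ℝ → HNeg1 Ω) (hf : MemLInftyHNeg1 f) (u₀ : L2 Ω)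
    (u : ℝ → L2 Ω) (U : ℝ → H10 Ω) (hu : IsWeakSolution f u₀ u U) :
    IsLeast (dirichletEigenvalues Ω) (lambda1 Ω) ∧ 0 < lambda1 Ω ∧
    ∀ α : ℝ, 0 < α → α < lambda1 Ω / 2 →
      0 < 1 - 2 * α / lambda1 Ω ∧
      ∀ t : ℝ, 0 ≤ t →
        IntervalIntegrable (fun s => Real.exp (2 * α * s) * ‖grad (U s)‖ ^ 2) volume 0 t ∧
        IntervalIntegrable (fun s => Real.exp (2 * α * s) * ‖grad (U s)‖ ^ 4) volume 0 t ∧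
        ‖u t‖ ^ 2
          + (1 - 2 * α / lambda1 Ω) * Real.exp (-2 * α * t) *
              (∫ s in (0 : ℝ)..t, Real.exp (2 * α * s) * ‖grad (U s)‖ ^ 2)
          + 2 * Real.exp (-2 * α * t) *
              (∫ s in (0 : ℝ)..t, Real.exp (2 * α * s) * ‖grad (U s)‖ ^ 4)
          ≤ Real.exp (-2 * α * t) * ‖u₀‖ ^ 2
              + 1 / (2 * α) * lInftyNorm f ^ 2 * (1 - Real.exp (-2 * α * t)) ∧
        Real.exp (-2 * α * t) * ‖u₀‖ ^ 2
              + 1 / (2 * α) * lInftyNorm f ^ 2 * (1 - Real.exp (-2 * α * t))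
          ≤ ‖u₀‖ ^ 2 + 1 / (2 * α) * lInftyNorm f ^ 2 := by
  have hd0 : d ≠ 0 := by omega
  obtain ⟨hleast, hpos, hpoin⟩ := isLeast_lambda1 hd0 hΩ.isBounded hΩ.isOpen hΩ.1
  have hN : ∀ᵐ t ∂(volume.restrict (Ioi (0 : ℝ))), ∀ v, |f t v| ≤ lInftyNorm f * ‖grad v‖ := by
    filter_upwards [ae_negNorm_le_lInftyNorm hf] with t ht v
    refine (abs_apply_le_negNorm hd0 hΩ.isBounded _ v).trans ?_
    gcongr
  refine ⟨hleast, hpos, fun α hα hαl => ?_⟩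
  have hβ : 0 < 1 - 2 * α / lambda1 Ω := by
    rw [sub_pos, div_lt_one hpos]; linarith
  refine ⟨hβ, fun t ht => ?_⟩
  obtain ⟨hint, hle⟩ := hu.energy_le hΩ.isBounded hN hpos hpoin hα hαl ht
  set β := 1 - 2 * α / lambda1 Ω
  have hmeas : AEStronglyMeasurable (fun s => grad (U s)) (volume.restrict (Ioc 0 t)) := by
    refine grad.continuous.comp_aestronglyMeasurable ?_
    refine (hu.memLp (t + 1) (by linarith)).1.mono_measure (Measure.restrict_mono ?_ le_rfl)
    exact fun s hs => ⟨hs.1, hs.2.trans_lt (by linarith)⟩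
  have hexpc : Continuous fun s : ℝ => Real.exp (2 * α * s) := by fun_prop
  have hint2 : IntervalIntegrable (fun s => Real.exp (2 * α * s) * ‖grad (U s)‖ ^ 2)
      volume 0 t := by
    rw [intervalIntegrable_iff_integrableOn_Ioc_of_le ht]
    -- Strict positivity of β is used here: the dissipation controls ‖∇u‖² only after division by β.
    refine (hint.const_mul β⁻¹).mono' (hexpc.aestronglyMeasurable.mul (hmeas.norm.pow 2))
      (Filter.Eventually.of_forall fun s => ?_)
    rw [Real.norm_of_nonneg (by positivity), ← div_eq_inv_mul, le_div_iff₀ hβ, dissipation]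
    have : 0 ≤ Real.exp (2 * α * s) * (2 * ‖grad (U s)‖ ^ 2 * ‖grad (U s)‖ ^ 2) := by positivity
    linarith
  have hint4 : IntervalIntegrable (fun s => Real.exp (2 * α * s) * ‖grad (U s)‖ ^ 4)
      volume 0 t := by
    rw [intervalIntegrable_iff_integrableOn_Ioc_of_le ht]
    refine hint.mono' (hexpc.aestronglyMeasurable.mul (hmeas.norm.pow 4))
      (Filter.Eventually.of_forall fun s => ?_)
    rw [Real.norm_of_nonneg (by positivity), dissipation]
    have h1 : 0 ≤ Real.exp (2 * α * s) * (β * ‖grad (U s)‖ ^ 2) := by positivity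
    have h2 : 0 ≤ Real.exp (2 * α * s) * ‖grad (U s)‖ ^ 4 := by positivity
    linarith
  have hsplit : ∫ s in (0 : ℝ)..t, dissipation α β s (U s) (U s)
      = β * (∫ s in (0 : ℝ)..t, Real.exp (2 * α * s) * ‖grad (U s)‖ ^ 2)
        + 2 * (∫ s in (0 : ℝ)..t, Real.exp (2 * α * s) * ‖grad (U s)‖ ^ 4) := by
    rw [← intervalIntegral.integral_const_mul, ← intervalIntegral.integral_const_mul,
      ← intervalIntegral.integral_add (hint2.const_mul β) (hint4.const_mul 2)]
    refine intervalIntegral.integral_congr fun s _ => ?_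
    simp only [dissipation]
    ring
  have hE1 : Real.exp (-2 * α * t) * Real.exp (2 * α * t) = 1 := by
    rw [← Real.exp_add, ← Real.exp_zero]; congr 1; ring
  refine ⟨hint2, hint4, ?_, ?_⟩
  · rw [hsplit] at hle
    -- Multiplying by e^{-2αt} undoes the exponential weight on ‖u(t)‖².
    have h1 := mul_le_mul_of_nonneg_left hle (Real.exp_pos (-2 * α * t)).le
    set E := Real.exp (-2 * α * t)
    set E' := Real.exp (2 * α * t)
    set I2 := ∫ s in (0 : ℝ)..t, Real.exp (2 * α * s) * ‖grad (U s)‖ ^ 2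
    set I4 := ∫ s in (0 : ℝ)..t, Real.exp (2 * α * s) * ‖grad (U s)‖ ^ 4
    have h2 : E * (E' * ‖u t‖ ^ 2 + (β * I2 + 2 * I4))
        = ‖u t‖ ^ 2 + β * E * I2 + 2 * E * I4 := by
      linear_combination ‖u t‖ ^ 2 * hE1
    have h3 : E * (‖u₀‖ ^ 2 + lInftyNorm f ^ 2 / (2 * α) * (E' - 1))
        = E * ‖u₀‖ ^ 2 + 1 / (2 * α) * lInftyNorm f ^ 2 * (1 - E) := by
      linear_combination lInftyNorm f ^ 2 / (2 * α) * hE1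
    linarith
  · have hE : Real.exp (-2 * α * t) ≤ 1 := Real.exp_le_one_iff.2 (by nlinarith)
    have hE0 := (Real.exp_pos (-2 * α * t)).le
    have h1 : 0 ≤ 1 / (2 * α) * lInftyNorm f ^ 2 := by positivity
    nlinarith [sq_nonneg ‖u₀‖]
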